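/- For $N\ge 0$ let $B_N$ be the algebra on $\{0,1,\dots,2^N-1\}$ whose binary operation $\backslash$ is defined by the recursive equations $0\backslash y=y$, $\;x\backslash(2^N-1)=x-1$ for $x>0$, and $x\backslash(y-1)=(x\backslash y)\backslash(x-1)$ for $x,y>0$. For $N\le N'$ the algebra $B_N$ is a subalgebra of $B_{N'}$; let $B_\infty=\bigcup_N B_N$, an algebra on the set of nonnegative integers, with operation again denoted $\backslash$. For $x>0$ the *period length* of $x$ in $B_\infty$ is the least positive period of the sequence $x\backslash 0,\ x\backslash 1,\ x\backslash 2,\dots$. **Corollary 4.2.** Let $a,x,m,n,l$ be nonnegative integers such that $n$ is a power of $2$ (that is, $n=2^k$ with $k\ge 0$), $2^{(m+1)n}\mid x$, and $a=x+2^{mn}(2^n-1)$. Suppose that $x+1$ has period length $2^l$ in $B_\infty$ and that $l\le n$. Then $a+1$ has period length $2^{l+n}$ in $B_\infty$, and $$(a+1)\backslash(2^n i+i')=\bigl((x+1)\backslash i\bigr)+2^{mn}i'$$ for all integers $i\ge 0$ and all integers $i'$ with $0\le i'<2^n$. -/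

import Mathlib

namespace LaverBack

/-- The operation of the backward finite algebra `B_n` on `{0, 1, …, 2^n - 1}`, given by
`0 ∖ y = y`, `x ∖ (2^n - 1) = x - 1` for `x > 0`, and
`x ∖ (y - 1) = (x ∖ y) ∖ (x - 1)` for `x, y > 0`.
The test `x ∖ (y + 1) < x` only serves the termination of the recursion: by `bOp_lt` it never
fails, and `bOp_zero`, `bOp_last`, `bOp_pred` are the three equations. Arguments outside
`{0, …, 2^n - 1}` are irrelevant. -/
def bOp (n : ℕ) (x y : ℕ) : ℕ :=
  if x = 0 then y
  else if 2 ^ n - 1 ≤ y then x - 1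
  else if bOp n x (y + 1) < x then bOp n (bOp n x (y + 1)) (x - 1) else 0
termination_by (x, 2 ^ n - 1 - y)

theorem bOp_zero (n y : ℕ) : bOp n 0 y = y := by
  rw [bOp]; simp

theorem bOp_lt (n : ℕ) {x : ℕ} (hx : 0 < x) (y : ℕ) : bOp n x y < x := by
  induction x using Nat.strong_induction_on generalizing y with
  | _ x ih =>
    rw [bOp, if_neg hx.ne']
    split_ifs with h1 h2
    · omega
    · rcases Nat.eq_zero_or_pos (bOp n x (y + 1)) with h0 | h0
      · rw [h0, bOp_zero]; omega
      · exact (ih _ h2 h0 _).trans h2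
    · exact hx

theorem bOp_last (n : ℕ) {x : ℕ} (hx : 0 < x) : bOp n x (2 ^ n - 1) = x - 1 := by
  rw [bOp, if_neg hx.ne', if_pos le_rfl]

theorem bOp_pred (n : ℕ) {x y : ℕ} (hx : 0 < x) (hy : 0 < y) (hyn : y < 2 ^ n) :
    bOp n x (y - 1) = bOp n (bOp n x y) (x - 1) := by
  have h := bOp_lt n hx y
  rw [bOp, if_neg hx.ne', if_neg (by omega), Nat.sub_add_cancel hy, if_pos h]

/-- Downward induction below `M`. -/
theorem down_induction {M : ℕ} {P : ℕ → Prop} (h0 : P (M - 1))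
    (hs : ∀ y, 0 < y → y < M → P y → P (y - 1)) : ∀ y, y < M → P y := by
  have key : ∀ k, k < M → P (M - 1 - k) := by
    intro k
    induction k with
    | zero => intro _; exact h0
    | succ k ih =>
      intro hk
      have := hs (M - 1 - k) (by omega) (by omega) (ih (by omega))
      rwa [show M - 1 - k - 1 = M - 1 - (k + 1) by omega] at this
  intro y hy
  have := key (M - 1 - y) (by omega)
  rwa [show M - 1 - (M - 1 - y) = y by omega] at this

theorem bOp_succ_aux (n : ℕ) (hz : ∀ x, 0 < x → x < 2 ^ n → bOp n x 0 = 0) (x : ℕ) :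
    0 < x → x < 2 ^ n → ∀ y, y < 2 ^ n →
      bOp (n + 1) x (y + 2 ^ n) = bOp n x y ∧ bOp (n + 1) x y = bOp n x y := by
  induction x using Nat.strong_induction_on with
  | _ x ih =>
    intro hx hxn
    have e2 : 2 ^ (n + 1) = 2 ^ n + 2 ^ n := by ring
    have step : ∀ r, r < x → bOp (n + 1) r (x - 1) = bOp n r (x - 1) := by
      intro r hr
      rcases Nat.eq_zero_or_pos r with rfl | h0
      · rw [bOp_zero, bOp_zero]
      · exact (ih r hr h0 (by omega) (x - 1) (by omega)).2
    have hi : ∀ y, y < 2 ^ n → bOp (n + 1) x (y + 2 ^ n) = bOp n x y := by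
      apply down_induction
      · rw [show 2 ^ n - 1 + 2 ^ n = 2 ^ (n + 1) - 1 by omega, bOp_last _ hx, bOp_last _ hx]
      · intro y hy hyn h
        rw [show y - 1 + 2 ^ n = y + 2 ^ n - 1 by omega,
          bOp_pred (n + 1) hx (by omega) (by omega), h, bOp_pred n hx hy hyn,
          step _ (bOp_lt n hx y)]
    have lo : ∀ y, y < 2 ^ n → bOp (n + 1) x y = bOp n x y := by
      apply down_induction
      · have h := hi 0 (by omega)
        rw [Nat.zero_add, hz x hx hxn] at h
        rw [bOp_pred (n + 1) hx (by omega) (by omega), h, bOp_zero, bOp_last n hx]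
      · intro y hy hyn h
        rw [bOp_pred (n + 1) hx (by omega) (by omega), h, bOp_pred n hx hy hyn,
          step _ (bOp_lt n hx y)]
    exact fun y hy => ⟨hi y hy, lo y hy⟩

theorem bOp_mod_aux (n : ℕ) (hz : ∀ x, 0 < x → x < 2 ^ n → bOp n x 0 = 0) (x : ℕ) :
    x < 2 ^ (n + 1) → ∀ y, y < 2 ^ (n + 1) →
      bOp (n + 1) x y % 2 ^ n = bOp n (x % 2 ^ n) (y % 2 ^ n) := by
  have e2 : 2 ^ (n + 1) = 2 ^ n + 2 ^ n := by ring
  have hp : 0 < 2 ^ n := by positivity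
  have pm : ∀ z, 0 < z →
      (z - 1) % 2 ^ n = if z % 2 ^ n = 0 then 2 ^ n - 1 else z % 2 ^ n - 1 := by
    intro z hzp
    have hd := Nat.div_add_mod z (2 ^ n)
    have hl := Nat.mod_lt z hp
    split_ifs with h
    · obtain ⟨q, hq⟩ : ∃ q, z / 2 ^ n = q + 1 := by
        refine ⟨z / 2 ^ n - 1, ?_⟩
        rcases Nat.eq_zero_or_pos (z / 2 ^ n) with h0 | h0
        · rw [h0] at hd; omega
        · omega
      rw [hq, h, Nat.mul_add] at hd
      rw [show z - 1 = 2 ^ n - 1 + 2 ^ n * q by omega, Nat.add_mul_mod_self_left,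
        Nat.mod_eq_of_lt (by omega)]
    · rw [show z - 1 = z % 2 ^ n - 1 + 2 ^ n * (z / 2 ^ n) by omega, Nat.add_mul_mod_self_left,
        Nat.mod_eq_of_lt (by omega)]
  induction x using Nat.strong_induction_on with
  | _ x ih =>
    intro hxn
    rcases Nat.eq_zero_or_pos x with rfl | hx
    · intro y _
      rw [bOp_zero, Nat.zero_mod, bOp_zero]
    have hxl := Nat.mod_lt x hp
    apply down_induction
    · rw [bOp_last _ hx, pm x hx, pm (2 ^ (n + 1)) (by omega)]
      simp only [e2, Nat.add_mod_right, Nat.mod_self, if_true]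
      split_ifs with h
      · rw [h, bOp_zero]
      · rw [bOp_last _ (by omega)]
    · intro y hy hyn h
      have hyl := Nat.mod_lt y hp
      rw [bOp_pred (n + 1) hx hy hyn, ih _ (bOp_lt _ hx y) ((bOp_lt _ hx y).trans hxn) _ (by omega),
        h, pm x hx, pm y hy]
      split_ifs with h1 h2 h2
      · rw [h1, h2]; simp only [bOp_zero]
      · rw [h1]; simp only [bOp_zero]
        rw [bOp_last _ (by omega)]
      · rw [h2, hz _ (by omega) hxl, bOp_zero, bOp_last _ (by omega)]
      · rw [bOp_pred n (by omega) (by omega) hyl]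

/-- `x ∖ 0 = 0` in `B_n` for `x ≠ 0`. -/
theorem bOp_zero_right (n : ℕ) : ∀ x, 0 < x → x < 2 ^ n → bOp n x 0 = 0 := by
  induction n with
  | zero => intro x h1 h2; simp at h2; omega
  | succ n hz =>
    intro x hx hxn
    have e2 : 2 ^ (n + 1) = 2 ^ n + 2 ^ n := by ring
    have hp : 0 < 2 ^ n := by positivity
    set e := (x - 1) % 2 ^ n with he
    have hel : e < 2 ^ n := Nat.mod_lt _ hp
    set f : ℕ → ℕ := fun r => bOp n r e with hf
    set F : ℕ → ℕ := fun r => bOp (n + 1) r (x - 1) with hF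
    have f0 : f 0 = e := bOp_zero _ _
    have F0 : F 0 = x - 1 := bOp_zero _ _
    have fle : ∀ r, r ≤ e → f r ≤ e := by
      intro r hr
      rcases Nat.eq_zero_or_pos r with rfl | h
      · exact f0.le
      · exact (bOp_lt n h e).le.trans hr
    have Fle : ∀ r, r ≤ x - 1 → F r ≤ x - 1 := by
      intro r hr
      rcases Nat.eq_zero_or_pos r with rfl | h
      · exact F0.le
      · exact (bOp_lt (n + 1) h (x - 1)).le.trans hr
    have fit : ∀ k, f^[k] e ≤ e := by
      intro k
      induction k with
      | zero => exact le_rfl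
      | succ k ih => rw [Function.iterate_succ_apply']; exact fle _ ih
    have Fit : ∀ k, F^[k] (x - 1) ≤ x - 1 := by
      intro k
      induction k with
      | zero => exact le_rfl
      | succ k ih => rw [Function.iterate_succ_apply']; exact Fle _ ih
    have fz : ∀ r, r ≤ e → f r = e → r = 0 := by
      intro r hr h
      by_contra h0
      have := bOp_lt n (Nat.pos_of_ne_zero h0) e
      simp only [hf] at h
      omega
    have Fz : ∀ r, r ≤ x - 1 → F r = x - 1 → r = 0 := by
      intro r hr h
      by_contra h0
      have := bOp_lt (n + 1) (Nat.pos_of_ne_zero h0) (x - 1)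
      simp only [hF] at h
      omega
    have semi : ∀ k, F^[k] (x - 1) % 2 ^ n = f^[k] e := by
      intro k
      induction k with
      | zero => rfl
      | succ k ih =>
        rw [Function.iterate_succ_apply', Function.iterate_succ_apply', ← ih]
        exact bOp_mod_aux n hz _ (lt_of_le_of_lt (Fit k) (by omega)) _ (by omega)
    -- rows read backwards
    have row : ∀ N u, 0 < u → ∀ k, k < 2 ^ N →
        (fun r => bOp N r (u - 1))^[k] (u - 1) = bOp N u (2 ^ N - 1 - k) := by
      intro N u hu k
      induction k with
      | zero => intro _; simp [bOp_last N hu]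
      | succ k ih =>
        intro hk
        rw [Function.iterate_succ_apply', ih (by omega),
          show 2 ^ N - 1 - (k + 1) = 2 ^ N - 1 - k - 1 by omega,
          bOp_pred N hu (by omega) (by omega)]
    have hper : Function.IsPeriodicPt f (2 ^ n) e := by
      have hlast : f^[2 ^ n - 1] e = 0 := by
        by_cases h : e + 1 < 2 ^ n
        · have := row n (e + 1) (by omega) (2 ^ n - 1) (by omega)
          rw [Nat.add_sub_cancel, Nat.sub_self, hz _ (by omega) h] at this
          exact this
        · have hee : e = 2 ^ n - 1 := by omega
          have hk : ∀ k, k < 2 ^ n → f^[k] e = 2 ^ n - 1 - k := by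
            intro k
            induction k with
            | zero => intro _; exact hee
            | succ k ih =>
              intro hk
              rw [Function.iterate_succ_apply', ih (by omega)]
              simp only [hf]
              rw [hee, bOp_last n (by omega)]
              omega
          rw [hk _ (by omega), Nat.sub_self]
      change f^[2 ^ n] e = e
      rw [show 2 ^ n = 2 ^ n - 1 + 1 by omega, Function.iterate_succ_apply', hlast, f0]
    set q := Function.minimalPeriod f e with hq
    have hqd : q ∣ 2 ^ n := hper.minimalPeriod_dvd
    have hq0 : 0 < q := hper.minimalPeriod_pos hp
    have hfq : f^[q] e = e := Function.isPeriodicPt_minimalPeriod f e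
    have fzero : ∀ k, f^[k] e = 0 → q ∣ k + 1 := by
      intro k h
      apply Function.IsPeriodicPt.minimalPeriod_dvd
      change f^[k + 1] e = e
      rw [Function.iterate_succ_apply', h, f0]
    have fq1 : ∀ k, q ∣ k + 1 → f^[k] e = 0 := by
      intro k h
      apply fz _ (fit k)
      rw [← Function.iterate_succ_apply' f]
      exact (Function.isPeriodicPt_minimalPeriod f e).trans_dvd h
    have hPer : Function.IsPeriodicPt F (2 * q) (x - 1) := by
      by_cases hcase : F^[q - 1] (x - 1) = 0
      · have : Function.IsPeriodicPt F q (x - 1) := by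
          change F^[q] (x - 1) = x - 1
          rw [show q = q - 1 + 1 by omega, Function.iterate_succ_apply', hcase, F0]
        exact this.trans_dvd ⟨2, by ring⟩
      · have hmod : F^[q - 1] (x - 1) % 2 ^ n = 0 := by
          rw [semi]; exact fq1 _ (by rw [Nat.sub_add_cancel hq0])
        have hval : F^[q - 1] (x - 1) ≤ 2 ^ n := by
          obtain ⟨c, hc⟩ := Nat.dvd_of_mod_eq_zero hmod
          have hl := Fit (q - 1)
          have : c < 2 := by
            by_contra hc2
            have : 2 ^ n * 2 ≤ 2 ^ n * c := Nat.mul_le_mul_left _ (by omega)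
            omega
          interval_cases c <;> omega
        have hlow : ∀ j, j < q → F^[q + j] (x - 1) < 2 ^ n := by
          intro j
          induction j with
          | zero =>
            intro _
            rw [Nat.add_zero, show q = q - 1 + 1 by omega, Function.iterate_succ_apply']
            exact lt_of_lt_of_le (bOp_lt _ (Nat.pos_of_ne_zero hcase) _) hval
          | succ j ih =>
            intro hj
            rw [show q + (j + 1) = q + j + 1 by omega, Function.iterate_succ_apply']
            have hne : F^[q + j] (x - 1) ≠ 0 := by
              intro h0
              have h1 := semi (q + j)
              rw [h0, Nat.zero_mod] at h1
              have h2 := fzero _ h1.symm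
              have h3 : q ∣ j + 1 := by
                rw [Nat.add_assoc] at h2
                exact (Nat.dvd_add_right dvd_rfl).1 h2
              have := Nat.le_of_dvd (by omega) h3
              omega
            exact (bOp_lt _ (Nat.pos_of_ne_zero hne) _).trans (ih (by omega))
        have hend : F^[q + (q - 1)] (x - 1) = 0 := by
          have h1 := semi (q + (q - 1))
          rw [fq1 _ ⟨2, by omega⟩, Nat.mod_eq_of_lt (hlow _ (by omega))] at h1
          exact h1
        change F^[2 * q] (x - 1) = x - 1
        rw [show 2 * q = q + (q - 1) + 1 by omega, Function.iterate_succ_apply', hend, F0]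
    have hfin : F^[2 ^ (n + 1)] (x - 1) = x - 1 :=
      hPer.trans_dvd (by rw [pow_succ, mul_comm]; exact Nat.mul_dvd_mul_right hqd 2)
    have hlast : F^[2 ^ (n + 1) - 1] (x - 1) = 0 := by
      apply Fz _ (Fit _)
      rw [← Function.iterate_succ_apply' F, Nat.succ_eq_add_one, Nat.sub_add_cancel (by omega), hfin]
    have := row (n + 1) x hx (2 ^ (n + 1) - 1) (by omega)
    rw [Nat.sub_self] at this
    rw [← this]; exact hlast

/-- `B_n` is a subalgebra of `B_N` for `n ≤ N`. -/
theorem bOp_mono {n N : ℕ} (h : n ≤ N) {x y : ℕ} (hx : x < 2 ^ n) (hy : y < 2 ^ n) :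
    bOp N x y = bOp n x y := by
  induction N, h using Nat.le_induction with
  | base => rfl
  | succ N hN ih =>
    rw [← ih]
    have hle : 2 ^ n ≤ 2 ^ N := Nat.pow_le_pow_right (by norm_num) hN
    rcases Nat.eq_zero_or_pos x with rfl | h0
    · rw [bOp_zero, bOp_zero]
    · exact (bOp_succ_aux N (bOp_zero_right N) x h0 (by omega) y (by omega)).2

/-- The operation `∖` of `B_∞ = ⋃ n, B_n`, with underlying set `ℕ`: the value of `x ∖ y` is
computed in the first `B_n` that contains both `x` and `y` (`Nat.size x` is the least `n` with
`x < 2 ^ n`). -/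
def bInf (x y : ℕ) : ℕ := bOp (max (Nat.size x) (Nat.size y)) x y

/-- The operation of `B_∞` restricts to that of each `B_n`. -/
theorem bInf_eq_bOp {n x y : ℕ} (hx : x < 2 ^ n) (hy : y < 2 ^ n) : bInf x y = bOp n x y :=
  (bOp_mono (max_le (Nat.size_le.2 hx) (Nat.size_le.2 hy))
    (Nat.size_le.1 (le_max_left _ _)) (Nat.size_le.1 (le_max_right _ _))).symm

/-- `p` is the period length of `x` in `B_∞`: the least positive period of the sequence
`x ∖ 0, x ∖ 1, x ∖ 2, …`. -/
def IsPeriodLength (x p : ℕ) : Prop :=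
  IsLeast {q : ℕ | 0 < q ∧ ∀ i : ℕ, bInf x (i + q) = bInf x i} p

end LaverBack

namespace LaverBack

-- A row is determined by its last value and a downward recursion, and `t ≡ (t + 1) ⊳ (2 ^ m - 1)`
-- modulo `2 ^ m`. Hence an endomorphism `F` that depends only on its argument modulo `2 ^ m` is the
-- row of `F (2 ^ m - 1) + 1`. So it suffices that `digitMap`, the right-hand side of the formula
-- with `s = m n`, is an endomorphism; its last value is `a`, and the period can be read off the
-- formula.
--
-- `digitMap` is multiplication by `2 ^ s` followed by `blockMap (s + n)`. The condition
-- `ShortPeriods n N` makes multiplication by `2 ^ N` a homomorphism modulo `2 ^ (N + n)`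
-- (`ShortPeriods.mul_op`) and then `blockMap N` an endomorphism (`op_add_of_op_eq_zero`,
-- `blockMap_op`). Used for all multiples of `n`, it improves the modulus for multiplication to `2 ^
-- (N + 2 n)` (`AllShortPeriods.mul_op_twice`), the precision needed for the composite.
--
-- It remains to prove `AllShortPeriods n`. The case `n = 1` is period doubling, and
-- `AllShortPeriods.double` passes from `n` to `2 n`; this is why `n` is a power of 2. In that step
-- let `N = K + 2 n`. If `2 ^ (K + n)` does not divide `z`, the row of `z` on multiples of `2 ^ (K +
-- n)` is a multiple of another row (`dvd_op_of_not_dvd`). Otherwise `z = 2 ^ N u + 2 ^ (K + n) r`,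
-- and the row of `2 ^ N u + 1` is `2 ^ N` times that of `u + 1`. If `2 ^ n` does not divide `u +
-- 1`, this has a short period and `add_op_two_pow` applies; if it does, explicit rows lead up to
-- `z` (`top_row`, `dvd_op_of_dvd_succ`).

infixl:72 " ⊳ " => bInf

/-! ### Recursion and reduction modulo powers of 2 -/

theorem exists_lt_two_pow (a : ℕ) : ∃ L, a < 2 ^ L := ⟨a, Nat.lt_two_pow_self⟩

theorem zero_op (y : ℕ) : 0 ⊳ y = y := bOp_zero _ _

theorem op_lt {x : ℕ} (hx : 0 < x) (y : ℕ) : x ⊳ y < x := bOp_lt _ hx y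

theorem op_last {M x : ℕ} (hx : 0 < x) (hM : x < 2 ^ M) : x ⊳ (2 ^ M - 1) = x - 1 := by
  rw [bInf_eq_bOp hM (by omega), bOp_last _ hx]

theorem op_step {x : ℕ} (hx : 0 < x) (y : ℕ) : x ⊳ y = (x ⊳ (y + 1)) ⊳ (x - 1) := by
  obtain ⟨L, hL⟩ := exists_lt_two_pow (x + y + 1)
  have h := op_lt hx (y + 1)
  rw [bInf_eq_bOp (n := L) (x := x) (y := y) (by omega) (by omega),
    bInf_eq_bOp (n := L) (by omega) (by omega),
    bInf_eq_bOp (n := L) (x := x) (y := y + 1) (by omega) (by omega),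
    ← bOp_pred L hx (by omega) (by omega), Nat.add_sub_cancel]

theorem op_zero (x : ℕ) : x ⊳ 0 = 0 := by
  rcases Nat.eq_zero_or_pos x with rfl | hx
  · exact zero_op 0
  · obtain ⟨L, hL⟩ := exists_lt_two_pow x
    rw [bInf_eq_bOp hL (by omega), bOp_zero_right L x hx hL]

theorem bOp_mod (M K x y : ℕ) (hx : x < 2 ^ (M + K)) (hy : y < 2 ^ (M + K)) :
    bOp (M + K) x y % 2 ^ M = bOp M (x % 2 ^ M) (y % 2 ^ M) := by
  induction K generalizing x y with
  | zero => rw [Nat.add_zero] at *; rw [Nat.mod_eq_of_lt hx, Nat.mod_eq_of_lt hy, Nat.mod_eq_of_lt]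
            rcases Nat.eq_zero_or_pos x with rfl | h
            · rwa [bOp_zero]
            · exact (bOp_lt _ h y).trans hx
  | succ K ih =>
    have hd : 2 ^ M ∣ 2 ^ (M + K) := Nat.pow_dvd_pow 2 (by omega)
    have hp : 0 < 2 ^ (M + K) := by positivity
    rw [← Nat.mod_mod_of_dvd (bOp (M + (K + 1)) x y) hd, ← Nat.add_assoc,
      bOp_mod_aux (M + K) (bOp_zero_right _) x hx y hy,
      ih _ _ (Nat.mod_lt _ hp) (Nat.mod_lt _ hp), Nat.mod_mod_of_dvd _ hd, Nat.mod_mod_of_dvd _ hd]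

theorem op_mod (M x y : ℕ) : (x ⊳ y) % 2 ^ M = (x % 2 ^ M) ⊳ (y % 2 ^ M) := by
  have hp : 0 < 2 ^ M := by positivity
  obtain ⟨K, hK⟩ := exists_lt_two_pow (x + y)
  have hK' : 2 ^ K ≤ 2 ^ (M + K) := Nat.pow_le_pow_right (by norm_num) (by omega)
  rw [bInf_eq_bOp (Nat.mod_lt _ hp) (Nat.mod_lt _ hp),
    bInf_eq_bOp (n := M + K) (by omega) (by omega), bOp_mod _ _ _ _ (by omega) (by omega)]

theorem op_modEq {M x x' y y' : ℕ} (hx : x ≡ x' [MOD 2 ^ M]) (hy : y ≡ y' [MOD 2 ^ M]) :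
    x ⊳ y ≡ x' ⊳ y' [MOD 2 ^ M] := by
  unfold Nat.ModEq at *
  rw [op_mod, hx, hy, ← op_mod]

/-- For `x < 2 ^ M` the value `x ⊳ y` only depends on `y` modulo `2 ^ M`. -/
theorem op_congr_right {M x y y' : ℕ} (hx0 : 0 < x) (hx : x ≤ 2 ^ M) (hy : y ≡ y' [MOD 2 ^ M]) :
    x ⊳ y = x ⊳ y' := by
  have h1 := op_lt hx0 y
  have h2 := op_lt hx0 y'
  exact Nat.ModEq.eq_of_lt_of_lt (op_modEq (Nat.ModEq.refl x) hy) (by omega) (by omega)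

/-- A row is determined by its recursion, read downwards. -/
theorem row_modEq {m X L₀ : ℕ} (hX : 0 < X) (F : ℕ → ℕ)
    (h0 : ∀ L, L₀ ≤ L → F (2 ^ L - 1) ≡ X - 1 [MOD 2 ^ m])
    (hs : ∀ t, F t ≡ F (t + 1) ⊳ (X - 1) [MOD 2 ^ m]) (t : ℕ) : X ⊳ t ≡ F t [MOD 2 ^ m] := by
  have hL : t + X < 2 ^ (t + X + L₀) :=
    lt_of_lt_of_le Nat.lt_two_pow_self (Nat.pow_le_pow_right (by norm_num) (by omega))
  have key : ∀ y, y < 2 ^ (t + X + L₀) → X ⊳ y ≡ F y [MOD 2 ^ m] := by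
    apply down_induction
    · rw [op_last hX (by omega)]
      exact (h0 _ (by omega)).symm
    · intro y hy _ ih
      rw [op_step hX, Nat.sub_add_cancel hy]
      refine (op_modEq ih rfl).trans ?_
      have := hs (y - 1)
      rw [Nat.sub_add_cancel hy] at this
      exact this.symm
  exact key t (by omega)

theorem row_eq {X L₀ : ℕ} (hX : 0 < X) (F : ℕ → ℕ) (h0 : ∀ L, L₀ ≤ L → F (2 ^ L - 1) = X - 1)
    (hs : ∀ t, F t = F (t + 1) ⊳ (X - 1)) (t : ℕ) : X ⊳ t = F t := by
  obtain ⟨m, hm⟩ := exists_lt_two_pow (X + F t)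
  have h := op_lt hX t
  exact Nat.ModEq.eq_of_lt_of_lt
    (row_modEq (m := m) hX F (fun L hL => by rw [h0 L hL]) (fun t => by rw [← hs t]) t)
    (by omega) (by omega)

/-! ### Distributivity and composition of rows -/

/-- Left distributivity. -/
theorem op_distrib (x y z : ℕ) : x ⊳ (y ⊳ z) = (x ⊳ y) ⊳ (x ⊳ z) := by
  induction x using Nat.strong_induction_on generalizing y z with
  | _ x ihx =>
  rcases Nat.eq_zero_or_pos x with rfl | hx
  · simp only [zero_op]
  induction y using Nat.strong_induction_on generalizing z with
  | _ y ihy =>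
  rcases Nat.eq_zero_or_pos y with rfl | hy
  · rw [zero_op, op_zero, zero_op]
  obtain ⟨L, hL⟩ := exists_lt_two_pow (x + y + z)
  -- The downward step in `z` uses the hypotheses for `y ⊳ z < y` and for `x ⊳ y < x`.
  have key : ∀ z, z < 2 ^ L → x ⊳ (y ⊳ z) = (x ⊳ y) ⊳ (x ⊳ z) := by
    apply down_induction
    · rw [op_last hy (by omega), op_last hx (by omega), op_step hx (y - 1), Nat.sub_add_cancel hy]
    · intro z hz _ ih
      rw [op_step hy (z - 1), op_step hx (z - 1), Nat.sub_add_cancel hz,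
        ihy _ (op_lt hy z), ih, ihx _ (op_lt hx y) (x ⊳ z) (x - 1), op_step hx (y - 1),
        Nat.sub_add_cancel hy]
  exact key z (by omega)

/-- By distributivity the composite of two rows satisfies a row recursion, with last value `x ⊳ y`.
-/
theorem op_comp (x y z : ℕ) : (x ⊳ y + 1) ⊳ z = x ⊳ ((y + 1) ⊳ z) := by
  refine row_eq (L₀ := y + 1) (Nat.succ_pos _) (fun z => x ⊳ ((y + 1) ⊳ z)) (fun L hL => ?_)
    (fun t => ?_) z
  · have : y + 1 < 2 ^ L := lt_of_lt_of_le Nat.lt_two_pow_self (Nat.pow_le_pow_right (by norm_num) hL)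
    simp only [op_last (Nat.succ_pos y) this]; rfl
  · change _ = _ ⊳ (x ⊳ y)
    rw [← op_distrib,
      op_step (Nat.succ_pos y) t, Nat.succ_sub_one]

/-! ### Zeros and periods of rows -/

/-- One zero gives a period: the row vanishes at `y + 2 ^ L z` and at `2 ^ L z`, and the same
recursion runs down from both. -/
theorem op_add_of_eq_zero {x y : ℕ} (hx : 0 < x) (h : x ⊳ y = 0) (z : ℕ) :
    x ⊳ (y + z) = x ⊳ z := by
  obtain ⟨L, hL⟩ := exists_lt_two_pow x
  have hB : z ≤ 2 ^ L * z := Nat.le_mul_of_pos_left _ (by positivity)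
  have hmod : ∀ w, x ⊳ (w + 2 ^ L * z) = x ⊳ w := fun w =>
    op_congr_right hx hL.le (by simp [Nat.ModEq])
  have key : ∀ t, t ≤ 2 ^ L * z → x ⊳ (y + 2 ^ L * z - t) = x ⊳ (2 ^ L * z - t) := by
    intro t
    induction t with
    | zero =>
      intro _
      have := hmod 0
      rw [Nat.zero_add] at this
      rw [Nat.sub_zero, Nat.sub_zero, hmod, this, h, op_zero]
    | succ t ih =>
      intro ht
      rw [op_step hx, op_step hx (2 ^ L * z - (t + 1)),
        show y + 2 ^ L * z - (t + 1) + 1 = y + 2 ^ L * z - t by omega,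
        show 2 ^ L * z - (t + 1) + 1 = 2 ^ L * z - t by omega, ih (by omega)]
  have := key (2 ^ L * z - z) (by omega)
  rwa [show y + 2 ^ L * z - (2 ^ L * z - z) = y + z by omega,
    show 2 ^ L * z - (2 ^ L * z - z) = z by omega] at this

theorem op_mul_add_of_eq_zero {x y : ℕ} (hx : 0 < x) (h : x ⊳ y = 0) (k z : ℕ) :
    x ⊳ (y * k + z) = x ⊳ z := by
  induction k with
  | zero => simp
  | succ k ih => rw [Nat.mul_succ, Nat.add_right_comm, Nat.add_comm, op_add_of_eq_zero hx h, ih]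

theorem op_eq_pred_of_eq_zero {x y w : ℕ} (hx : 0 < x) (h : x ⊳ y = 0) (hy : y ∣ w + 1) :
    x ⊳ w = x - 1 := by
  obtain ⟨k, hk⟩ := hy
  rw [op_step hx w, hk, ← Nat.add_zero (y * k), op_mul_add_of_eq_zero hx h, op_zero, zero_op]

/-- The odd factor is invertible modulo a power of 2, so some multiple of the period is congruent to
`2 ^ c`. -/
theorem op_pow_eq_zero {x c o : ℕ} (hx : 0 < x) (ho : Odd o) (h : x ⊳ (2 ^ c * o) = 0) :
    x ⊳ 2 ^ c = 0 := by
  obtain ⟨L, hL⟩ := exists_lt_two_pow x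
  have hL1 : 1 < 2 ^ (L + 1) := Nat.one_lt_two_pow (by omega)
  have hc : Nat.Coprime o (2 ^ (L + 1)) := (Nat.coprime_two_right.2 ho).pow_right _
  obtain ⟨k, hk⟩ := Nat.exists_mul_mod_eq_one_of_coprime hc hL1
  have h1 := op_mul_add_of_eq_zero hx h k 0
  rw [op_zero, Nat.add_zero] at h1
  rw [← h1]
  apply op_congr_right (M := L + 1) hx (hL.le.trans (Nat.pow_le_pow_right (by norm_num) (by omega)))
  rw [Nat.mul_assoc]
  have : o * k ≡ 1 [MOD 2 ^ (L + 1)] := by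
    unfold Nat.ModEq; rw [hk.2, Nat.mod_eq_of_lt hL1]
  simpa using (Nat.ModEq.mul_left (2 ^ c) this).symm

theorem op_self_modEq_of_dvd {M x : ℕ} (h : 2 ^ M ∣ x) (y : ℕ) : x ⊳ y ≡ y [MOD 2 ^ M] := by
  have := op_modEq (y := y) ((Nat.modEq_zero_iff_dvd).2 h) rfl
  rwa [zero_op] at this

theorem op_eq_zero_of_dvd {M x y : ℕ} (hx0 : 0 < x) (hx : x ≤ 2 ^ M) (h : 2 ^ M ∣ x ⊳ y) :
    x ⊳ y = 0 := Nat.eq_zero_of_dvd_of_lt h ((op_lt hx0 y).trans_le hx)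

theorem mod_op_eq_zero {M x y : ℕ} (hx : ¬ 2 ^ M ∣ x) (h : 2 ^ M ∣ x ⊳ y) :
    0 < x % 2 ^ M ∧ (x % 2 ^ M) ⊳ y = 0 := by
  have h0 : 0 < x % 2 ^ M := Nat.pos_of_ne_zero fun h => hx (Nat.dvd_of_mod_eq_zero h)
  refine ⟨h0, op_eq_zero_of_dvd h0 (Nat.mod_lt _ (by positivity)).le ?_⟩
  exact (Nat.ModEq.dvd_iff (op_modEq (Nat.mod_modEq x _) rfl) dvd_rfl).2 h

theorem op_modEq_mod_left (M x y : ℕ) : (x % 2 ^ M) ⊳ y ≡ x ⊳ y [MOD 2 ^ M] :=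
  op_modEq (Nat.mod_modEq x _) rfl

theorem op_mul_add_modEq {M x y : ℕ} (h : 2 ^ M ∣ x ⊳ y) (k z : ℕ) :
    x ⊳ (y * k + z) ≡ x ⊳ z [MOD 2 ^ M] := by
  by_cases hx : 2 ^ M ∣ x
  · refine (op_self_modEq_of_dvd hx _).trans (Nat.ModEq.trans ?_ (op_self_modEq_of_dvd hx _).symm)
    have hy : 2 ^ M ∣ y := (Nat.ModEq.dvd_iff (op_self_modEq_of_dvd hx y) dvd_rfl).1 h
    simpa using ((Nat.modEq_zero_iff_dvd).2 (hy.mul_right k)).add_right z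
  · obtain ⟨h0, h1⟩ := mod_op_eq_zero hx h
    refine (op_modEq_mod_left M x _).symm.trans (Nat.ModEq.trans ?_ (op_modEq_mod_left M x _))
    rw [op_mul_add_of_eq_zero h0 h1]

theorem op_dvd_of_dvd {M x y w : ℕ} (h : 2 ^ M ∣ x ⊳ y) (hw : y ∣ w) : 2 ^ M ∣ x ⊳ w := by
  obtain ⟨k, rfl⟩ := hw
  have := op_mul_add_modEq h k 0
  rw [op_zero] at this
  exact (Nat.modEq_zero_iff_dvd).1 this

theorem op_pow_dvd {M x c o : ℕ} (ho : Odd o) (h : 2 ^ M ∣ x ⊳ (2 ^ c * o)) : 2 ^ M ∣ x ⊳ 2 ^ c := by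
  by_cases hx : 2 ^ M ∣ x
  · have h1 := (Nat.ModEq.dvd_iff (op_self_modEq_of_dvd hx _) dvd_rfl).1 h
    refine (Nat.ModEq.dvd_iff (op_self_modEq_of_dvd hx _) dvd_rfl).2 ?_
    exact Nat.Coprime.dvd_of_dvd_mul_right
      (Nat.Coprime.pow_left _ (Nat.coprime_two_left.2 ho)) h1
  · obtain ⟨h0, h1⟩ := mod_op_eq_zero hx h
    have := op_pow_eq_zero h0 ho h1
    exact (Nat.ModEq.dvd_iff (op_modEq_mod_left M x _) dvd_rfl).1 (this ▸ dvd_zero _)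

theorem op_lt_op_succ {x y : ℕ} (hx : 0 < x) (h : x ⊳ (y + 1) ≠ 0) : x ⊳ y < x ⊳ (y + 1) := by
  rw [op_step hx y]; exact op_lt (Nat.pos_of_ne_zero h) _

/-! ### Period doubling -/

/-- The period of a row at most doubles from `2 ^ M` to `2 ^ (M + 1)`. -/
theorem op_double {M x c : ℕ} (h : 2 ^ M ∣ x ⊳ 2 ^ c) : 2 ^ (M + 1) ∣ x ⊳ 2 ^ (c + 1) := by
  by_cases hx : 2 ^ (M + 1) ∣ x
  · refine (Nat.ModEq.dvd_iff (op_self_modEq_of_dvd hx _) dvd_rfl).2 ?_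
    have h1 := (Nat.ModEq.dvd_iff
      (op_self_modEq_of_dvd ((Nat.pow_dvd_pow 2 (Nat.le_succ M)).trans hx) _) dvd_rfl).1 h
    rw [pow_succ, pow_succ]; exact Nat.mul_dvd_mul_right h1 2
  set x' := x % 2 ^ (M + 1) with hx'
  have h0 : 0 < x' := Nat.pos_of_ne_zero fun h => hx (Nat.dvd_of_mod_eq_zero h)
  have hlt : x' < 2 ^ (M + 1) := Nat.mod_lt _ (by positivity)
  have hM : ∀ y, 2 ^ M ∣ x ⊳ y → 2 ^ M ∣ x' ⊳ y := fun y hy =>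
    (Nat.ModEq.dvd_iff (op_modEq_mod_left (M + 1) x y) (Nat.pow_dvd_pow 2 (Nat.le_succ M))).2 hy
  refine (Nat.ModEq.dvd_iff (op_modEq_mod_left (M + 1) x _) dvd_rfl).1 ?_
  rw [← hx']
  have val : ∀ y, 2 ^ M ∣ x ⊳ y → x' ⊳ y = 0 ∨ x' ⊳ y = 2 ^ M := by
    intro y hy
    obtain ⟨k, hk⟩ := hM y hy
    have := op_lt h0 y
    have h2 : k < 2 := by
      by_contra h2
      have : 2 ^ M * 2 ≤ 2 ^ M * k := Nat.mul_le_mul_left _ (by omega)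
      rw [pow_succ] at hlt; omega
    interval_cases k <;> omega
  have hz : 2 ^ (c + 1) = 2 ^ c + 2 ^ c := by ring
  rcases val _ h with h1 | h1
  · rw [hz, op_add_of_eq_zero h0 h1, h1]; exact dvd_zero _
  rcases val _ (op_dvd_of_dvd h (Nat.pow_dvd_pow 2 (Nat.le_succ c))) with h2 | h2
  · rw [Nat.succ_eq_add_one] at h2; rw [h2]; exact dvd_zero _
  exfalso
  -- The remaining case has the value `2 ^ M` at both `2 ^ c` and `2 ^ (c + 1)`. A zero in between
  -- would force one at some `2 ^ d` with `d ≤ c`, hence at `2 ^ c`; so the row increases strictly,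
  -- which contradicts the equal end values.
  have mono : ∀ k, k ≤ 2 ^ c → x' ⊳ (2 ^ c) + k ≤ x' ⊳ (2 ^ c + k) := by
    intro k
    induction k with
    | zero => intro _; simp
    | succ k ih =>
      intro hk
      by_cases hzero : x' ⊳ (2 ^ c + k + 1) = 0
      · exfalso
        obtain ⟨d, o, ho, hd⟩ := Nat.exists_eq_two_pow_mul_odd (n := 2 ^ c + k + 1) (by omega)
        rw [hd] at hzero
        have h3 := op_pow_eq_zero h0 ho hzero
        by_cases hdc : d ≤ c
        · obtain ⟨k, hk⟩ := Nat.pow_dvd_pow 2 hdc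
          have := op_mul_add_of_eq_zero h0 h3 k 0
          rw [← hk, Nat.add_zero, op_zero, h1] at this
          exact absurd this (by positivity)
        · have h4 : 2 ^ (c + 1) ≤ 2 ^ d := Nat.pow_le_pow_right (by norm_num) (by omega)
          have h5 : 2 ^ d * 1 ≤ 2 ^ d * o := Nat.mul_le_mul_left _ ho.pos
          have h6 : k + 1 = 2 ^ c := by omega
          have h7 : 2 ^ c + k + 1 = 2 ^ (c + 1) := by omega
          rw [← hd, h7, h2] at hzero
          exact absurd hzero (by positivity)
      · have := op_lt_op_succ h0 hzero
        have := ih (by omega)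
        rw [← Nat.add_assoc (2 ^ c)]; omega
  have := mono (2 ^ c) le_rfl
  rw [← hz, h2, h1] at this
  have : 0 < 2 ^ c := by positivity
  omega

/-- Only multiples of `2 ^ n` have a full period modulo `2 ^ n`. -/
theorem op_half {n y : ℕ} (hy : ¬ 2 ^ (n + 1) ∣ y) : 2 ^ (n + 1) ∣ y ⊳ 2 ^ n := by
  induction n with
  | zero =>
    have h1 : y ≡ 1 [MOD 2 ^ (0 + 1)] := by
      unfold Nat.ModEq; norm_num at hy ⊢; omega
    refine (Nat.ModEq.dvd_iff (op_modEq h1 rfl) dvd_rfl).2 ?_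
    have := op_lt (x := 1) (by norm_num) (2 ^ 0)
    rw [Nat.lt_one_iff.1 this]; exact dvd_zero _
  | succ n ih =>
    by_cases h : 2 ^ (n + 1) ∣ y
    · obtain ⟨k, rfl⟩ := h
      have hk : k % 2 = 1 := by
        by_contra h
        obtain ⟨j, rfl⟩ : 2 ∣ k := by omega
        exact hy ⟨j, by ring⟩
      have h1 : 2 ^ (n + 1) * k ≡ 2 ^ (n + 1) [MOD 2 ^ (n + 1 + 1)] := by
        have : k ≡ 1 [MOD 2] := hk
        have := Nat.ModEq.mul_left' (2 ^ (n + 1)) this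
        rwa [← pow_succ, Nat.mul_one] at this
      refine (Nat.ModEq.dvd_iff (op_modEq h1 rfl) dvd_rfl).2 ?_
      rw [op_eq_zero_of_dvd (M := n + 1) (by positivity) le_rfl]
      · exact dvd_zero _
      · exact (Nat.ModEq.dvd_iff (op_self_modEq_of_dvd dvd_rfl _) dvd_rfl).2 dvd_rfl
    · exact op_double (ih h)

/-! ### Short periods and multiplication by a power of 2 -/

/-- Modulo `2 ^ (N + n)`, every row that does not start at a multiple of `2 ^ N` has a period
dividing `2 ^ N`. -/
def ShortPeriods (n N : ℕ) : Prop := ∀ z, ¬ 2 ^ N ∣ z → 2 ^ (N + n) ∣ z ⊳ 2 ^ N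

theorem op_pred_modEq {M z y w : ℕ} (hz : 0 < z) (h : 2 ^ M ∣ z ⊳ y) (hy : y ∣ w + 1) :
    z ⊳ w ≡ z - 1 [MOD 2 ^ M] := by
  rw [op_step hz w]
  have := op_modEq (y := z - 1) ((Nat.modEq_zero_iff_dvd).2 (op_dvd_of_dvd h hy)) rfl
  rwa [zero_op] at this

theorem two_pow_sub_one_div_mod {N L : ℕ} (h : N ≤ L) :
    (2 ^ L - 1) / 2 ^ N = 2 ^ (L - N) - 1 ∧ (2 ^ L - 1) % 2 ^ N = 2 ^ N - 1 := by
  have hp : 0 < 2 ^ N := by positivity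
  have hq : 0 < 2 ^ (L - N) := by positivity
  have : 2 ^ L - 1 = 2 ^ N * (2 ^ (L - N) - 1) + (2 ^ N - 1) := by
    have : 2 ^ L = 2 ^ N * 2 ^ (L - N) := by rw [← pow_add]; congr 1; omega
    rw [this, Nat.mul_sub, Nat.mul_one]
    have := Nat.le_mul_of_pos_right (2 ^ N) hq
    omega
  rw [this, Nat.mul_add_div hp, Nat.div_eq_of_lt (by omega), Nat.mul_add_mod,
    Nat.mod_eq_of_lt (by omega)]
  simp

theorem digits_div_mod {Q w j : ℕ} (hj : j < Q) : (Q * w + j) / Q = w ∧ (Q * w + j) % Q = j := by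
  rw [Nat.mul_add_div (by omega), Nat.div_eq_of_lt hj, Nat.mul_add_mod, Nat.mod_eq_of_lt hj]
  simp

theorem digits_succ {Q : ℕ} (hQ : 0 < Q) (t : ℕ) :
    (∃ w j, j + 1 < Q ∧ t = Q * w + j ∧ t + 1 = Q * w + (j + 1)) ∨
      ∃ w, t = Q * w + (Q - 1) ∧ t + 1 = Q * (w + 1) + 0 := by
  have h1 := Nat.div_add_mod t Q
  have h2 := Nat.mod_lt t hQ
  by_cases h : t % Q + 1 < Q
  · exact Or.inl ⟨t / Q, t % Q, h, by omega, by omega⟩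
  · exact Or.inr ⟨t / Q, by omega, by rw [Nat.mul_add]; omega⟩

theorem mul_pred_eq {Q y : ℕ} (hQ : 0 < Q) (hy : 0 < y) : Q * y - 1 = Q * (y - 1) + (Q - 1) := by
  obtain ⟨y, rfl⟩ := Nat.exists_eq_succ_of_ne_zero hy.ne'
  rw [Nat.succ_sub_one, Nat.mul_succ]; omega

/-- Multiplication by `2 ^ N` is a homomorphism modulo `2 ^ (N + n)`. -/
theorem ShortPeriods.mul_op {n N : ℕ} (h : ShortPeriods n N) (y w j : ℕ) (hj : j < 2 ^ N) :
    (2 ^ N * y) ⊳ (2 ^ N * w + j) ≡ 2 ^ N * (y ⊳ w) + j [MOD 2 ^ (N + n)] := by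
  have hQ : 0 < 2 ^ N := by positivity
  induction y using Nat.strong_induction_on generalizing w j with
  | _ y ih =>
  rcases Nat.eq_zero_or_pos y with rfl | hy
  · rw [Nat.mul_zero, zero_op, zero_op]
  have hX : 0 < 2 ^ N * y := by positivity
  have key := row_modEq (m := N + n) (L₀ := N + y) hX
    (fun v => 2 ^ N * (y ⊳ (v / 2 ^ N)) + v % 2 ^ N) (fun L hL => ?_) (fun t => ?_) (2 ^ N * w + j)
  · simpa only [(digits_div_mod hj).1, (digits_div_mod hj).2] using key
  · obtain ⟨h1, h2⟩ := two_pow_sub_one_div_mod (N := N) (L := L) (by omega)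
    have : y < 2 ^ (L - N) :=
      lt_of_lt_of_le Nat.lt_two_pow_self (Nat.pow_le_pow_right (by norm_num) (by omega))
    simp only [h1, h2, op_last hy this, mul_pred_eq hQ hy]
    rfl
  -- Inside a block the element is not a multiple of `2 ^ N`, so by its short period the index `2 ^
  -- N y - 1` yields its predecessor. Across a block boundary the step is the recursion for the row
  -- of `y`.
  · rcases digits_succ hQ t with ⟨w, j, hj, h1, h2⟩ | ⟨w, h1, h2⟩
    · simp only [h2, (digits_div_mod hj).1, (digits_div_mod hj).2]
      simp only [h1, (digits_div_mod (show j < 2 ^ N by omega)).1,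
        (digits_div_mod (show j < 2 ^ N by omega)).2]
      refine (op_pred_modEq (z := 2 ^ N * (y ⊳ w) + (j + 1)) (w := 2 ^ N * y - 1)
        (by omega) (h _ ?_) ?_).symm
      · rw [Nat.dvd_add_right (Dvd.intro _ rfl)]
        exact Nat.not_dvd_of_pos_of_lt (by omega) hj
      · rw [Nat.sub_add_cancel hX]; exact Dvd.intro _ rfl
    · simp only [h2, (digits_div_mod hQ).1, (digits_div_mod hQ).2]
      simp only [h1, (digits_div_mod (show 2 ^ N - 1 < 2 ^ N by omega)).1,
        (digits_div_mod (show 2 ^ N - 1 < 2 ^ N by omega)).2]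
      rw [mul_pred_eq hQ hy, Nat.add_zero, op_step hy w]
      exact (ih _ (op_lt hy _) _ _ (by omega)).symm

/-! ### Block maps are endomorphisms -/

/-- `q w + j ↦ f ⊳ w + j` for `j < 2 ^ N`, where `q = 2 ^ N`. -/
def blockMap (N f v : ℕ) : ℕ := f ⊳ (v / 2 ^ N) + v % 2 ^ N

theorem blockMap_add {N f w j : ℕ} (hj : j < 2 ^ N) : blockMap N f (2 ^ N * w + j) = f ⊳ w + j := by
  rw [blockMap, (digits_div_mod hj).1, (digits_div_mod hj).2]

theorem blockMap_congr {n N f v v' : ℕ} (hf0 : 0 < f) (hf : f ⊳ 2 ^ n = 0)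
    (h : v ≡ v' [MOD 2 ^ (N + n)]) : blockMap N f v = blockMap N f v' := by
  have h1 : v % 2 ^ N = v' % 2 ^ N := h.of_dvd (Nat.pow_dvd_pow 2 (Nat.le_add_right _ _))
  have hp : ∀ u, f ⊳ u = f ⊳ (u % 2 ^ n) := fun u => by
    conv_lhs => rw [← Nat.div_add_mod u (2 ^ n)]
    exact op_mul_add_of_eq_zero hf0 hf _ _
  have h2 : v / 2 ^ N % 2 ^ n = v' / 2 ^ N % 2 ^ n := by
    unfold Nat.ModEq at h
    rw [pow_add] at h
    rw [← Nat.mod_mul_right_div_self, h, Nat.mod_mul_right_div_self]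
  rw [blockMap, blockMap, h1, hp, h2, ← hp]

theorem dvd_op_of_modEq_one {N x y : ℕ} (hx : 2 ^ N ∣ x) : 2 ^ N ∣ (x + 1) ⊳ y := by
  have h : x + 1 ≡ 0 + 1 [MOD 2 ^ N] := ((Nat.modEq_zero_iff_dvd).2 hx).add_right 1
  refine (Nat.ModEq.dvd_iff (op_modEq h rfl) dvd_rfl).2 ?_
  rw [Nat.lt_one_iff.1 (op_lt (x := 0 + 1) (by norm_num) y)]; exact dvd_zero _

/-- Lifts the congruence `h₂` to an equality when `x` has at most one bit more. Raising `j` by one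
must raise the left side by one. If `d` is the new value and `C = (x + 1) ⊳ y`, this says `d ⊳ (C -
1) = d - 1`, which holds once `d ⊳ 2 ^ N = 0` because `2 ^ N` divides `C`. -/
theorem op_add_of_shift {n N M x : ℕ} (hn : 1 ≤ n) (hx : 2 ^ N ∣ x) (hf : (x + 1) ⊳ 2 ^ n = 0)
    (hM : x < 2 ^ (M + 1))
    (h₁ : ∀ e, e < x → 2 ^ N ∣ e → (e + 1) ⊳ 2 ^ n = 0 → ∀ j, 0 < j → j < 2 ^ N →
      (e + j) ⊳ 2 ^ N = 0)
    (h₂ : ∀ y w j, j < 2 ^ N → ((x + 1) ⊳ y) ⊳ ((x + 1) ⊳ w + j) ≡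
      (x + 1) ⊳ (y ⊳ w) + j [MOD 2 ^ M])
    (y w j : ℕ) (hj : j < 2 ^ N) :
    ((x + 1) ⊳ y) ⊳ ((x + 1) ⊳ w + j) = (x + 1) ⊳ (y ⊳ w) + j := by
  obtain ⟨n, rfl⟩ : ∃ k, n = k + 1 := ⟨n - 1, by omega⟩
  have hf0 : 0 < x + 1 := Nat.succ_pos x
  rcases Nat.eq_zero_or_pos ((x + 1) ⊳ y) with h0 | h0
  · rw [op_distrib, h0, zero_op, zero_op]
  have hC := op_lt hf0 y
  have hCQ : 2 ^ N ∣ (x + 1) ⊳ y := dvd_op_of_modEq_one hx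
  have hDQ : 2 ^ N ∣ (x + 1) ⊳ w := dvd_op_of_modEq_one hx
  have hy : 0 < y % 2 ^ (n + 1) := by
    refine Nat.pos_of_ne_zero fun h => h0.ne' ?_
    obtain ⟨k, rfl⟩ := Nat.dvd_of_mod_eq_zero h
    rw [← Nat.add_zero (2 ^ (n + 1) * k), op_mul_add_of_eq_zero hf0 hf, op_zero]
  have hyw : ¬ 2 ^ (n + 1) ∣ y ⊳ w + 1 := by
    intro h
    have h1 := op_mod (n + 1) y w
    have h2 := op_lt hy (w % 2 ^ (n + 1))
    have h3 := Nat.mod_lt y (show 0 < 2 ^ (n + 1) by positivity)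
    have h4 := Nat.mod_eq_zero_of_dvd h
    rw [Nat.add_mod, h1, Nat.mod_eq_of_lt (show 1 < 2 ^ (n + 1) from
      Nat.one_lt_two_pow (by omega)), Nat.mod_eq_of_lt (by omega)] at h4
    omega
  induction j with
  | zero => exact (op_distrib _ _ _).symm
  | succ j ih =>
    have ih := ih (by omega)
    set C := (x + 1) ⊳ y
    set D := (x + 1) ⊳ w
    set d := C ⊳ (D + (j + 1)) with hd
    have hdj : d ≡ j + 1 [MOD 2 ^ N] := by
      refine (op_self_modEq_of_dvd hCQ _).trans ?_
      simpa using ((Nat.modEq_zero_iff_dvd).2 hDQ).add_right (j + 1)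
    have hde : 2 ^ N * (d / 2 ^ N) + (j + 1) = d := by
      have h1 := Nat.div_add_mod d (2 ^ N)
      rw [hdj, Nat.mod_eq_of_lt hj] at h1
      exact h1
    set e := 2 ^ N * (d / 2 ^ N)
    have hdC : d < C := op_lt h0 _
    have he : e ≡ (x + 1) ⊳ (y ⊳ w) [MOD 2 ^ M] := by
      have := h₂ y w (j + 1) hj
      rw [← hd, ← hde] at this
      exact Nat.ModEq.add_right_cancel' _ this
    -- Here `n` is one less than in the statement. By `op_comp` the row of `e + 1` modulo `2 ^ M`
    -- factors through that of `y ⊳ w + 1`, which by `op_half` reaches a multiple of `2 ^ (n + 1)`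
    -- already at `2 ^ n`. The factor 2 saved pays for the extra bit in `he3`.
    have he2 : 2 ^ M ∣ (e + 1) ⊳ 2 ^ n := by
      refine (Nat.ModEq.dvd_iff (op_modEq (he.add_right 1) rfl) dvd_rfl).2 ?_
      rw [op_comp]
      obtain ⟨k, hk⟩ := op_half hyw
      rw [hk, ← Nat.add_zero (2 ^ (n + 1) * k), op_mul_add_of_eq_zero hf0 hf, op_zero]
      exact dvd_zero _
    have he3 : (e + 1) ⊳ 2 ^ (n + 1) = 0 :=
      op_eq_zero_of_dvd (Nat.succ_pos e) (by omega) (op_double he2)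
    have he4 := h₁ e (by omega) (Dvd.intro _ rfl) he3 (j + 1) (by omega) hj
    rw [hde] at he4
    have h5 := op_eq_pred_of_eq_zero (w := C - 1) (by omega) he4 (by rwa [Nat.sub_add_cancel h0])
    have h6 := op_step h0 (D + j)
    rw [Nat.add_assoc D j 1, ← hd] at h6
    omega

/-- Induction on `z`. For multiples of `2 ^ N` combine `hb` with `ShortPeriods.mul_op`. For other
`z` the block map commutes with taking predecessors, so the row recursion and the short period carry
over. -/
theorem blockMap_op_of_shift {n N x : ℕ} (h : ShortPeriods n N)
    (hf : (x + 1) ⊳ 2 ^ n = 0) (hx : 2 ^ N ∣ x)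
    (hb : ∀ y w j, j < 2 ^ N → ((x + 1) ⊳ y) ⊳ ((x + 1) ⊳ w + j) = (x + 1) ⊳ (y ⊳ w) + j)
    (z : ℕ) : (∀ w, blockMap N (x + 1) z ⊳ blockMap N (x + 1) w = blockMap N (x + 1) (z ⊳ w)) ∧
      (¬ 2 ^ N ∣ z → blockMap N (x + 1) z ⊳ 2 ^ N = 0) := by
  have hQ : 0 < 2 ^ N := by positivity
  have hf0 := Nat.succ_pos x
  induction z using Nat.strong_induction_on with
  | _ z ih =>
  by_cases hz : 2 ^ N ∣ z
  · refine ⟨fun w => ?_, fun h => absurd hz h⟩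
    obtain ⟨y, rfl⟩ := hz
    have h1 : blockMap N (x + 1) (2 ^ N * y) = (x + 1) ⊳ y := by
      have := blockMap_add (f := x + 1) (w := y) hQ
      simpa using this
    rw [h1, blockMap, hb _ _ _ (Nat.mod_lt _ hQ), ← blockMap_add (Nat.mod_lt _ hQ)]
    apply blockMap_congr hf0 hf
    conv_rhs => rw [← Nat.div_add_mod w (2 ^ N)]
    exact (h.mul_op _ _ _ (Nat.mod_lt _ hQ)).symm
  · have hzp : 0 < z := Nat.pos_of_ne_zero fun h => hz (h ▸ dvd_zero _)
    have hzm : 0 < z % 2 ^ N := Nat.pos_of_ne_zero fun h => hz (Nat.dvd_of_mod_eq_zero h)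
    have hG0 : 0 < blockMap N (x + 1) z := by unfold blockMap; omega
    have hGp : blockMap N (x + 1) z - 1 = blockMap N (x + 1) (z - 1) := by
      obtain ⟨w, j, hj, rfl⟩ : ∃ w j, j + 1 < 2 ^ N ∧ z = 2 ^ N * w + (j + 1) :=
        ⟨z / 2 ^ N, z % 2 ^ N - 1, by have := Nat.mod_lt z hQ; omega,
          by have := Nat.div_add_mod z (2 ^ N); omega⟩
      rw [blockMap_add hj, ← Nat.add_assoc, ← Nat.add_assoc, Nat.add_sub_cancel,
        Nat.add_sub_cancel, blockMap_add (by omega)]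
    have row : ∀ t, blockMap N (x + 1) z ⊳ t = blockMap N (x + 1) (z ⊳ t) := by
      refine row_eq (L₀ := z) hG0 _ (fun L hL => ?_) (fun t => ?_)
      · have : z < 2 ^ L :=
          lt_of_lt_of_le Nat.lt_two_pow_self (Nat.pow_le_pow_right (by norm_num) hL)
        rw [op_last hzp this, hGp]
      · rw [hGp, (ih _ (op_lt hzp _)).1, ← op_step hzp]
    have hdv := h z hz
    have hzero : blockMap N (x + 1) z ⊳ 2 ^ N = 0 := by
      rw [row, blockMap_congr hf0 hf ((Nat.modEq_zero_iff_dvd).2 hdv)]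
      simp [blockMap, op_zero]
    refine ⟨fun w => ?_, fun _ => hzero⟩
    have h1 : blockMap N (x + 1) w = 2 ^ N * (((x + 1) ⊳ (w / 2 ^ N)) / 2 ^ N) + w % 2 ^ N := by
      rw [Nat.mul_div_cancel' (dvd_op_of_modEq_one hx), blockMap]
    rw [h1, op_mul_add_of_eq_zero hG0 hzero, row]
    apply blockMap_congr hf0 hf
    conv_rhs => rw [← Nat.div_add_mod w (2 ^ N)]
    exact (op_mul_add_modEq hdv _ _).symm

/-- Induction on `x`: deleting its leading bit gives the congruence modulo `2 ^ M`, and the block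
maps of smaller `e + 1` give the zeros required in `op_add_of_shift`. -/
theorem op_add_of_op_eq_zero {n N : ℕ} (h : ShortPeriods n N) (hn : 1 ≤ n) (x : ℕ)
    (hx : 2 ^ N ∣ x) (hf : (x + 1) ⊳ 2 ^ n = 0) (y w j : ℕ) (hj : j < 2 ^ N) :
    ((x + 1) ⊳ y) ⊳ ((x + 1) ⊳ w + j) = (x + 1) ⊳ (y ⊳ w) + j := by
  induction x using Nat.strong_induction_on generalizing y w j with
  | _ x ih =>
  rcases Nat.eq_zero_or_pos x with rfl | hx0
  · have h1 : ∀ t, (0 + 1) ⊳ t = 0 := fun t => Nat.lt_one_iff.1 (op_lt (by norm_num) t)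
    simp only [h1, zero_op]
  set M := Nat.log 2 x with hM
  have hM1 : 2 ^ M ≤ x := Nat.pow_log_le_self 2 hx0.ne'
  have hM2 : x < 2 ^ (M + 1) := Nat.lt_pow_succ_log_self (by norm_num) x
  have hNM : N ≤ M := by
    have := (Nat.le_of_dvd hx0 hx).trans_lt hM2
    have := (Nat.pow_lt_pow_iff_right (a := 2) (by norm_num)).1 this
    omega
  refine op_add_of_shift hn hx hf hM2 (fun e he heN hek j hj0 hj => ?_) (fun y w j hj => ?_) y w j hj
  -- The argument is chosen so that its image under the block map is `e + j`.
  · have h1 := (blockMap_op_of_shift h hek heN (ih e he heN hek)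
      (2 ^ N * (2 ^ n - 1) + j)).2 ?_
    · rw [blockMap_add hj] at h1
      rwa [op_eq_pred_of_eq_zero (Nat.succ_pos e) hek
        (by rw [Nat.sub_add_cancel (Nat.two_pow_pos n)])] at h1
    · rw [Nat.dvd_add_right (Dvd.intro _ rfl)]
      exact Nat.not_dvd_of_pos_of_lt hj0 hj
  · have hx' : x % 2 ^ M + 1 ≡ x + 1 [MOD 2 ^ M] := (Nat.mod_modEq x _).add_right 1
    have hlt : x % 2 ^ M < 2 ^ M := Nat.mod_lt _ (by positivity)
    have := ih (x % 2 ^ M) (by omega) ?_ ?_ y w j hj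
    · have e1 : ∀ t, (x % 2 ^ M + 1) ⊳ t ≡ (x + 1) ⊳ t [MOD 2 ^ M] := fun t => op_modEq hx' rfl
      have e2 := op_modEq (e1 y) ((e1 w).add_right j)
      rw [this] at e2
      exact e2.symm.trans ((e1 _).add_right j)
    · exact (Nat.dvd_mod_iff (Nat.pow_dvd_pow 2 hNM)).2 hx
    · refine op_eq_zero_of_dvd (M := M) (Nat.succ_pos _) (by omega) ?_
      refine (Nat.ModEq.dvd_iff (op_modEq hx' rfl) dvd_rfl).2 ?_
      rw [hf]; exact dvd_zero _

section

variable {n N x : ℕ}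

theorem blockMap_op (h : ShortPeriods n N) (hn : 1 ≤ n) (hx : 2 ^ N ∣ x)
    (hf : (x + 1) ⊳ 2 ^ n = 0) (z w : ℕ) :
    blockMap N (x + 1) z ⊳ blockMap N (x + 1) w = blockMap N (x + 1) (z ⊳ w) :=
  (blockMap_op_of_shift h hf hx (op_add_of_op_eq_zero h hn x hx hf) z).1 w

theorem add_op_two_pow (h : ShortPeriods n N) (hn : 1 ≤ n) (hx : 2 ^ N ∣ x)
    (hf : (x + 1) ⊳ 2 ^ n = 0) {j : ℕ} (hj0 : 0 < j) (hj : j < 2 ^ N) : (x + j) ⊳ 2 ^ N = 0 := by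
  have h1 := (blockMap_op_of_shift h hf hx (op_add_of_op_eq_zero h hn x hx hf)
    (2 ^ N * (2 ^ n - 1) + j)).2 ?_
  · rw [blockMap_add hj] at h1
    rwa [op_eq_pred_of_eq_zero (Nat.succ_pos x) hf
      (by rw [Nat.sub_add_cancel (Nat.two_pow_pos n)])] at h1
  · rw [Nat.dvd_add_right (Dvd.intro _ rfl)]
    exact Nat.not_dvd_of_pos_of_lt hj0 hj

theorem pred_modEq_op (m t : ℕ) : t ⊳ (2 ^ m - 1) ≡ t + (2 ^ m - 1) [MOD 2 ^ m] := by
  have hp : 0 < 2 ^ m := by positivity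
  by_cases ht : 2 ^ m ∣ t
  · refine (op_self_modEq_of_dvd ht _).trans ?_
    simpa using (((Nat.modEq_zero_iff_dvd).2 ht).add_right (2 ^ m - 1)).symm
  · have ht0 : 0 < t := Nat.pos_of_ne_zero fun h => ht (h ▸ dvd_zero _)
    have h2 : 2 ^ m ∣ t ⊳ 2 ^ m := by
      refine (Nat.ModEq.dvd_iff (op_modEq rfl ((Nat.modEq_zero_iff_dvd).2 dvd_rfl)) dvd_rfl).2 ?_
      rw [op_zero]; exact dvd_zero _
    refine (op_pred_modEq ht0 h2 (by rw [Nat.sub_add_cancel hp])).trans ?_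
    rw [show t + (2 ^ m - 1) = t - 1 + 2 ^ m by omega]
    simp [Nat.ModEq]

/-- Applied inside a homomorphism, this is the row recursion. -/
theorem succ_op_last (m t : ℕ) : (t + 1) ⊳ (2 ^ m - 1) ≡ t [MOD 2 ^ m] := by
  refine (pred_modEq_op m (t + 1)).trans ?_
  have hp : 0 < 2 ^ m := by positivity
  rw [show t + 1 + (2 ^ m - 1) = t + 2 ^ m by omega]
  simp [Nat.ModEq]

theorem two_pow_sub_one_modEq {m L : ℕ} (h : m ≤ L) : 2 ^ L - 1 ≡ 2 ^ m - 1 [MOD 2 ^ m] := by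
  unfold Nat.ModEq
  have := Nat.two_pow_pos m
  rw [(two_pow_sub_one_div_mod h).2, Nat.mod_eq_of_lt (by omega)]

/-- The row of `x + 2 ^ N`, where the row of `x + 1` has a period dividing `2 ^ n`. -/
theorem add_two_pow_op (h : ShortPeriods n N) (hn : 1 ≤ n) (hx : 2 ^ N ∣ x)
    (hf : (x + 1) ⊳ 2 ^ n = 0) (t : ℕ) : (x + 2 ^ N) ⊳ t = blockMap N (x + 1) t := by
  have hQ : 0 < 2 ^ N := by positivity
  have hlast : x + 2 ^ N - 1 = blockMap N (x + 1) (2 ^ (N + n) - 1) := by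
    rw [blockMap, (two_pow_sub_one_div_mod (Nat.le_add_right N n)).1,
      (two_pow_sub_one_div_mod (Nat.le_add_right N n)).2, Nat.add_sub_cancel_left,
      op_eq_pred_of_eq_zero (Nat.succ_pos x) hf (by rw [Nat.sub_add_cancel (Nat.two_pow_pos n)])]
    omega
  refine row_eq (L₀ := N + n) (by omega) _ (fun L hL => ?_) (fun t => ?_) t
  · rw [hlast]
    exact blockMap_congr (Nat.succ_pos x) hf (two_pow_sub_one_modEq hL)
  · rw [hlast, blockMap_op h hn hx hf]
    exact blockMap_congr (Nat.succ_pos x) hf (succ_op_last _ t).symm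

end

/-! ### The improved modulus and digit maps -/

/-- Multiplication by `2 ^ N` is a homomorphism even modulo `2 ^ (N + 2 n)`. -/
theorem ShortPeriods.mul_op_twice {n N : ℕ} (hn : 1 ≤ n) (h : ShortPeriods n N)
    (h₁ : ShortPeriods n (N + n)) (h₂ : ShortPeriods n n) (z w j : ℕ) (hj : j < 2 ^ N) :
    (2 ^ N * z) ⊳ (2 ^ N * w + j) ≡ 2 ^ N * (z ⊳ w) + j [MOD 2 ^ (N + n + n)] := by
  have hQ := Nat.two_pow_pos N
  have hq := Nat.two_pow_pos n
  induction z using Nat.strong_induction_on generalizing w j with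
  | _ z ih =>
  by_cases hz : 2 ^ n ∣ z
  · obtain ⟨y, rfl⟩ := hz
    have hw := Nat.div_add_mod w (2 ^ n)
    have hwl := Nat.mod_lt w hq
    set w₁ := w / 2 ^ n
    set w₀ := w % 2 ^ n
    have e1 : 2 ^ N * w + j = 2 ^ (N + n) * w₁ + (2 ^ N * w₀ + j) := by rw [← hw]; ring
    have hlt : 2 ^ N * w₀ + j < 2 ^ (N + n) := by
      have : 2 ^ N * (w₀ + 1) ≤ 2 ^ N * 2 ^ n := Nat.mul_le_mul_left _ hwl
      rw [pow_add]; rw [Nat.mul_add] at this; omega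
    have k1 := h₁.mul_op y w₁ _ hlt
    have k2 := (h₂.mul_op y w₁ _ hwl).mul_left' (2 ^ N)
    rw [hw, ← pow_add, ← Nat.add_assoc] at k2
    rw [e1, ← Nat.mul_assoc, ← pow_add]
    refine k1.trans (Nat.ModEq.trans ?_ (k2.add_right j).symm)
    have e : 2 ^ (N + n) * (y ⊳ w₁) + (2 ^ N * w₀ + j) =
        2 ^ N * (2 ^ n * (y ⊳ w₁) + w₀) + j := by ring
    rw [e]
  · have hz0 : 0 < z := Nat.pos_of_ne_zero fun h => hz (h ▸ dvd_zero _)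
    -- As `2 ^ n` does not divide `z`, this row has period `2 ^ n` modulo `2 ^ (N + 2 n)`;
    -- `add_two_pow_op` then describes the row of `2 ^ N (z - 1) + 2 ^ N`.
    have row : ∀ t, (2 ^ N * (z - 1) + 1) ⊳ t ≡ 2 ^ N * (z ⊳ t) [MOD 2 ^ (N + n + n)] := by
      refine row_modEq (L₀ := z) (Nat.succ_pos _) _ (fun L hL => ?_) (fun t => ?_)
      · have : z < 2 ^ L :=
          lt_of_lt_of_le Nat.lt_two_pow_self (Nat.pow_le_pow_right (by norm_num) hL)
        simp only [op_last hz0 this]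
        rfl
      · have := ih _ (op_lt hz0 (t + 1)) (z - 1) 0 hQ
        rw [← op_step hz0] at this
        exact this.symm
    set x := 2 ^ N * (z - 1) % 2 ^ (N + n + n) with hx
    have hx1 : x ≡ 2 ^ N * (z - 1) [MOD 2 ^ (N + n + n)] := Nat.mod_modEq _ _
    have hxlt : x < 2 ^ (N + n + n) := Nat.mod_lt _ (by positivity)
    have hxN : 2 ^ N ∣ x := (Nat.dvd_mod_iff (Nat.pow_dvd_pow 2 (by omega))).2 (Dvd.intro _ rfl)
    have row' : ∀ t, (x + 1) ⊳ t ≡ 2 ^ N * (z ⊳ t) [MOD 2 ^ (N + n + n)] := fun t =>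
      (op_modEq (hx1.add_right 1) rfl).trans (row t)
    have hf : (x + 1) ⊳ 2 ^ n = 0 := by
      refine op_eq_zero_of_dvd (M := N + n + n) (Nat.succ_pos _) (by omega) ?_
      refine (Nat.ModEq.dvd_iff (row' _) dvd_rfl).2 ?_
      rw [Nat.add_assoc, pow_add]
      exact Nat.mul_dvd_mul_left _ (h₂ z hz)
    have k := add_two_pow_op h hn hxN hf (2 ^ N * w + j)
    rw [blockMap_add hj] at k
    have hxz : 2 ^ N * z ≡ x + 2 ^ N [MOD 2 ^ (N + n + n)] := by
      have := (hx1.add_right (2 ^ N)).symm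
      rwa [← Nat.mul_succ, Nat.succ_eq_add_one, Nat.sub_add_cancel hz0] at this
    refine (op_modEq hxz rfl).trans ?_
    rw [k]
    exact (row' w).add_right j

/-- All the congruences `ShortPeriods n N` for `N` a multiple of `n`. -/
def AllShortPeriods (n : ℕ) : Prop := ∀ N, n ∣ N → ShortPeriods n N

theorem AllShortPeriods.mul_op_twice {n N : ℕ} (hn : 1 ≤ n) (h : AllShortPeriods n) (hN : n ∣ N)
    (z w j : ℕ) (hj : j < 2 ^ N) :
    (2 ^ N * z) ⊳ (2 ^ N * w + j) ≡ 2 ^ N * (z ⊳ w) + j [MOD 2 ^ (N + n + n)] :=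
  (h N hN).mul_op_twice hn (h _ (Nat.dvd_add hN dvd_rfl)) (h n dvd_rfl) z w j hj

/-- `2 ^ n i + i' ↦ f ⊳ i + 2 ^ s i'` for `i' < 2 ^ n`. -/
def digitMap (n s f v : ℕ) : ℕ := f ⊳ (v / 2 ^ n) + 2 ^ s * (v % 2 ^ n)

theorem digitMap_add {n s f i i' : ℕ} (h : i' < 2 ^ n) :
    digitMap n s f (2 ^ n * i + i') = f ⊳ i + 2 ^ s * i' := by
  rw [digitMap, (digits_div_mod h).1, (digits_div_mod h).2]

theorem digitMap_eq_blockMap (n s f v : ℕ) : digitMap n s f v = blockMap (s + n) f (2 ^ s * v) := by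
  rw [digitMap, blockMap, pow_add, Nat.mul_div_mul_left _ _ (by positivity), Nat.mul_mod_mul_left]

section

variable {n s x : ℕ}

theorem digitMap_congr {f v v' : ℕ} (hf0 : 0 < f) (hf : f ⊳ 2 ^ n = 0)
    (h : v ≡ v' [MOD 2 ^ (n + n)]) : digitMap n s f v = digitMap n s f v' := by
  rw [digitMap_eq_blockMap, digitMap_eq_blockMap]
  apply blockMap_congr hf0 hf
  rw [Nat.add_assoc, pow_add]
  exact h.mul_left' _

/-- `blockMap (s + n)` sees its argument only modulo `2 ^ (s + 2 n)`, where multiplication by `2 ^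
s` is a homomorphism. -/
theorem digitMap_op (hn : 1 ≤ n) (h : AllShortPeriods n) (hs : n ∣ s) (hx : 2 ^ (s + n) ∣ x)
    (hf : (x + 1) ⊳ 2 ^ n = 0) (z w : ℕ) :
    digitMap n s (x + 1) z ⊳ digitMap n s (x + 1) w = digitMap n s (x + 1) (z ⊳ w) := by
  simp only [digitMap_eq_blockMap]
  rw [blockMap_op (h _ (Nat.dvd_add hs dvd_rfl)) hn hx hf]
  exact blockMap_congr (Nat.succ_pos x) hf (h.mul_op_twice hn hs z w 0 (by positivity))

theorem add_mul_op (hn : 1 ≤ n) (h : AllShortPeriods n) (hs : n ∣ s) (hx : 2 ^ (s + n) ∣ x)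
    (hf : (x + 1) ⊳ 2 ^ n = 0) (t : ℕ) :
    (x + 2 ^ s * (2 ^ n - 1) + 1) ⊳ t = digitMap n s (x + 1) t := by
  -- Both base `2 ^ n` digits of the last index are `2 ^ n - 1`.
  have hlast : x + 2 ^ s * (2 ^ n - 1) = digitMap n s (x + 1) (2 ^ (n + n) - 1) := by
    rw [digitMap, (two_pow_sub_one_div_mod (Nat.le_add_right n n)).1,
      (two_pow_sub_one_div_mod (Nat.le_add_right n n)).2, Nat.add_sub_cancel_left,
      op_eq_pred_of_eq_zero (Nat.succ_pos x) hf (by rw [Nat.sub_add_cancel (Nat.two_pow_pos n)]),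
      Nat.succ_sub_one]
  refine row_eq (L₀ := n + n) (Nat.succ_pos _) _ (fun L hL => ?_) (fun t => ?_) t
  · rw [Nat.succ_sub_one, hlast]
    exact digitMap_congr (Nat.succ_pos x) hf (two_pow_sub_one_modEq hL)
  · rw [Nat.succ_sub_one, hlast, digitMap_op hn h hs hx hf]
    exact digitMap_congr (Nat.succ_pos x) hf (succ_op_last _ t).symm

end

/-! ### Short periods: the case 1 and elements of low order -/

theorem allShortPeriods_one : AllShortPeriods 1 := by
  intro N _ z hz
  cases N with
  | zero => exact absurd (by simp) hz
  | succ N => exact op_double (op_half hz)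

theorem op_congr_of_dvd {M c z v w : ℕ} (h : 2 ^ M ∣ z ⊳ 2 ^ c) (hvw : v ≡ w [MOD 2 ^ c]) :
    z ⊳ v ≡ z ⊳ w [MOD 2 ^ M] := by
  have e : ∀ t, z ⊳ t ≡ z ⊳ (t % 2 ^ c) [MOD 2 ^ M] := fun t => by
    conv_lhs => rw [← Nat.div_add_mod t (2 ^ c)]
    exact op_mul_add_modEq h _ _
  have h1 := e v
  rw [hvw] at h1
  exact h1.trans (e w).symm

/-- If `z` has low order, then `z ⊳ (2 ^ K i) = 2 ^ (K + n) h i` for a homomorphism `h`, which is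
itself given by a row. -/
theorem dvd_op_of_not_dvd {n K z : ℕ} (hn : 1 ≤ n) (h : AllShortPeriods n) (hK : n ∣ K)
    (ih : ∀ y, y < z → ¬ 2 ^ (K + n) ∣ y → 2 ^ (K + n + n + n) ∣ y ⊳ 2 ^ (K + n))
    (hz : ¬ 2 ^ K ∣ z) : 2 ^ (K + n + n + n) ∣ z ⊳ 2 ^ (K + n) := by
  have hz0 : 0 < z := Nat.pos_of_ne_zero fun h => hz (h ▸ dvd_zero _)
  have hKn : n ∣ K + n := Nat.dvd_add hK dvd_rfl
  have hz1 : 2 ^ (K + n) ∣ z ⊳ 2 ^ K := h K hK z hz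
  have hz2 : 2 ^ (K + n + n + n) ∣ z ⊳ 2 ^ (K + (n + n)) := by
    rw [← Nat.add_assoc]
    exact h _ (Nat.dvd_add hKn dvd_rfl) z fun hd =>
      hz ((Nat.pow_dvd_pow 2 (by omega)).trans hd)
  obtain ⟨e, he⟩ : ∃ e : ℕ → ℕ, ∀ i, z ⊳ (2 ^ K * i) = 2 ^ (K + n) * e i :=
    ⟨fun i => (z ⊳ (2 ^ K * i)) / 2 ^ (K + n), fun i =>
      (Nat.mul_div_cancel' (op_dvd_of_dvd hz1 (Dvd.intro _ rfl))).symm⟩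
  have cancel : ∀ v w, 2 ^ (K + n) * v ≡ 2 ^ (K + n) * w [MOD 2 ^ (K + n + n + n)] →
      v ≡ w [MOD 2 ^ (n + n)] := fun v w hvw => by
    rw [Nat.add_assoc (K + n), pow_add 2 (K + n)] at hvw
    exact Nat.ModEq.mul_left_cancel' (Nat.two_pow_pos _).ne' hvw
  have e_congr : ∀ v w, v ≡ w [MOD 2 ^ (n + n)] → e v ≡ e w [MOD 2 ^ (n + n)] := by
    intro v w hvw
    apply cancel
    rw [← he, ← he]
    apply op_congr_of_dvd hz2
    rw [pow_add]
    exact hvw.mul_left' _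
  have e_op : ∀ v w, e (v ⊳ w) ≡ e v ⊳ e w [MOD 2 ^ (n + n)] := by
    intro v w
    apply cancel
    rw [← he]
    have h1 := h.mul_op_twice hn hK v w 0 (Nat.two_pow_pos _)
    have h2 := h.mul_op_twice hn hKn (e v) (e w) 0 (Nat.two_pow_pos _)
    rw [Nat.add_zero, Nat.add_zero] at h1 h2
    rw [Nat.add_assoc K] at h1
    refine (op_congr_of_dvd hz2 h1.symm).trans ?_
    rw [op_distrib, he, he]
    exact h2
  have row : ∀ t, (e (2 ^ (n + n) - 1) + 1) ⊳ t ≡ e t [MOD 2 ^ (n + n)] := by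
    refine row_modEq (L₀ := n + n) (Nat.succ_pos _) e (fun L hL => ?_) (fun t => ?_)
    · exact e_congr _ _ (two_pow_sub_one_modEq hL)
    · exact (e_congr _ _ (succ_op_last (n + n) t).symm).trans (e_op _ _)
  have he1 : z ⊳ 2 ^ K = 2 ^ (K + n) * e 1 := by have := he 1; rwa [Nat.mul_one] at this
  have hen : z ⊳ 2 ^ (K + n) = 2 ^ (K + n) * e (2 ^ n) := by rw [← he, ← pow_add]
  by_cases hE : 2 ^ n ∣ e (2 ^ (n + n) - 1) + 1
  -- Here `e 1 ≡ 1`, so `z ⊳ 2 ^ K ≡ 2 ^ (K + n)`, and distributivity moves the claim from `z` to `z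
  -- ⊳ z < z`.
  · obtain ⟨y, hy⟩ := hE
    have h1 : e 1 ≡ 1 [MOD 2 ^ (n + n)] := by
      have h2 := (h n dvd_rfl).mul_op y 0 1 (Nat.one_lt_two_pow (by omega))
      rw [Nat.mul_zero, Nat.zero_add, op_zero, Nat.mul_zero, Nat.zero_add, ← hy] at h2
      exact (row 1).symm.trans h2
    have h2 : z ⊳ 2 ^ K ≡ 2 ^ (K + n) [MOD 2 ^ (K + n + n + n)] := by
      have := h1.mul_left' (2 ^ (K + n))
      rwa [Nat.mul_one, ← pow_add, ← he1, ← Nat.add_assoc] at this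
    have h3 : z ⊳ 2 ^ (K + n) ≡ (z ⊳ z) ⊳ 2 ^ (K + n) [MOD 2 ^ (K + n + n + n)] := by
      refine (op_modEq rfl h2.symm).trans ?_
      rw [op_distrib]
      exact op_modEq rfl h2
    refine (Nat.ModEq.dvd_iff h3 dvd_rfl).2 (ih _ (op_lt hz0 z) fun hd => ?_)
    -- If `2 ^ (K + n)` divided `z ⊳ z`, it would divide `z ⊳ 2 ^ v`; one doubling then makes `z ⊳ 2
    -- ^ K` divisible by `2 ^ (K + n + 1)`, against `h2`.
    obtain ⟨v, o, ho, hv⟩ := Nat.exists_eq_two_pow_mul_odd hz0.ne'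
    have hvK : v < K := by
      by_contra hc
      exact hz (hv ▸ (Nat.pow_dvd_pow 2 (by omega)).trans (Dvd.intro _ rfl))
    have h4 : 2 ^ (K + n) ∣ z ⊳ 2 ^ v := op_pow_dvd ho (hv ▸ hd)
    have h5 : 2 ^ (K + n + 1) ∣ z ⊳ 2 ^ K :=
      op_dvd_of_dvd (op_double h4) (Nat.pow_dvd_pow 2 hvK)
    have h6 := (Nat.ModEq.dvd_iff h2 (Nat.pow_dvd_pow 2 (by omega))).1 h5
    have := (Nat.pow_dvd_pow_iff_le_right (x := 2) (by norm_num)).1 h6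
    omega
  · have h1 := (Nat.ModEq.dvd_iff (row (2 ^ n)) dvd_rfl).1 (h n dvd_rfl _ hE)
    rw [hen, Nat.add_assoc (K + n), pow_add 2 (K + n)]
    exact Nat.mul_dvd_mul_left _ h1

/-! ### Explicit rows above a multiple of a power of 2 -/

theorem op_two_pow_self {M x : ℕ} (hx : x ≤ 2 ^ M) (hx0 : 0 < x) : x ⊳ 2 ^ M = 0 := by
  rw [op_congr_right hx0 hx (show 2 ^ M ≡ 0 [MOD 2 ^ M] by simp [Nat.ModEq]), op_zero]

theorem two_pow_op (n t : ℕ) : 2 ^ n ⊳ t = t % 2 ^ n := by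
  have h := op_self_modEq_of_dvd (dvd_refl (2 ^ n)) t
  rw [← Nat.mod_eq_of_lt (op_lt (Nat.two_pow_pos n) t)]
  exact h

/-- The recursion gives this modulo `2 ^ (N + 2 n)`, and the bound on `u` keeps both sides below
that modulus. -/
theorem mul_add_one_op {n N u : ℕ} (hn : 1 ≤ n) (h : AllShortPeriods n) (hN : n ∣ N)
    (hu : u < 2 ^ (n + n)) (t : ℕ) : (2 ^ N * u + 1) ⊳ t = 2 ^ N * ((u + 1) ⊳ t) := by
  have hQ := Nat.two_pow_pos N
  have key : (2 ^ N * u + 1) ⊳ t ≡ 2 ^ N * ((u + 1) ⊳ t) [MOD 2 ^ (N + n + n)] := by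
    refine row_modEq (L₀ := u + 1) (Nat.succ_pos _) (fun t => 2 ^ N * ((u + 1) ⊳ t))
      (fun L hL => ?_) (fun t => ?_) t
    · have : u + 1 < 2 ^ L :=
        lt_of_lt_of_le Nat.lt_two_pow_self (Nat.pow_le_pow_right (by norm_num) hL)
      simp only [op_last (Nat.succ_pos u) this]
      rfl
    · have := h.mul_op_twice hn hN ((u + 1) ⊳ (t + 1)) u 0 hQ
      have h1 := op_step (Nat.succ_pos u) t
      rw [Nat.succ_sub_one] at h1
      rw [← h1] at this
      exact this.symm
  have hle : 2 ^ N * (u + 1) ≤ 2 ^ (N + n + n) := by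
    rw [Nat.add_assoc, pow_add]
    exact Nat.mul_le_mul_left _ hu
  have h1 : (2 ^ N * u + 1) ⊳ t < 2 ^ N * u + 1 := op_lt (Nat.succ_pos _) t
  have h2 : 2 ^ N * ((u + 1) ⊳ t) ≤ 2 ^ N * u :=
    Nat.mul_le_mul_left _ (Nat.le_of_lt_succ (op_lt (Nat.succ_pos u) t))
  rw [Nat.mul_succ] at hle
  exact Nat.ModEq.eq_of_lt_of_lt key (by omega) (by omega)

theorem mul_pred_add_lt {Q y j : ℕ} (hy : 0 < y) (hj : j < Q) : Q * (y - 1) + j < Q * y := by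
  have := mul_pred_eq (Q := Q) (by omega) hy
  have := Nat.mul_pos (show 0 < Q by omega) hy
  omega

/-- `q y + r ↦ 2 ^ N y + 2 ^ s r` for `y, r < q`, where `q = 2 ^ n`, except that
`q (q - 1) + r ↦ 2 ^ N u + 2 ^ s r` for `r > 0`. -/
def topMap (n N s u v : ℕ) : ℕ :=
  if 2 ^ n * (2 ^ n - 1) < v then 2 ^ N * u + 2 ^ s * (v % 2 ^ n)
  else 2 ^ N * (v / 2 ^ n) + 2 ^ s * (v % 2 ^ n)

theorem topMap_low {n N s u y r : ℕ} (hr : r < 2 ^ n) (hy : y + 1 < 2 ^ n) :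
    topMap n N s u (2 ^ n * y + r) = 2 ^ N * y + 2 ^ s * r := by
  have := mul_pred_add_lt (Nat.succ_pos y) hr
  rw [Nat.succ_sub_one] at this
  have h2 : 2 ^ n * y.succ ≤ 2 ^ n * (2 ^ n - 1) := Nat.mul_le_mul_left _ (by omega)
  rw [topMap, if_neg (by omega), (digits_div_mod hr).1, (digits_div_mod hr).2]

theorem topMap_mul {n N s u y : ℕ} (hy : y < 2 ^ n) : topMap n N s u (2 ^ n * y) = 2 ^ N * y := by
  have h2 : 2 ^ n * y ≤ 2 ^ n * (2 ^ n - 1) := Nat.mul_le_mul_left _ (by omega)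
  rw [topMap, if_neg (by omega), Nat.mul_div_cancel_left _ (Nat.two_pow_pos n), Nat.mul_mod_right]
  simp

theorem topMap_zero (n N s u : ℕ) : topMap n N s u 0 = 0 := by
  simp [topMap]

theorem topMap_top {n N s u r : ℕ} (hr0 : 0 < r) (hr : r < 2 ^ n) :
    topMap n N s u (2 ^ n * (2 ^ n - 1) + r) = 2 ^ N * u + 2 ^ s * r := by
  rw [topMap, if_pos (by omega), (digits_div_mod hr).2]

theorem ShortPeriods.op_eq_zero {n N z : ℕ} (h : ShortPeriods n N) (hz : ¬ 2 ^ N ∣ z)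
    (hlt : z ≤ 2 ^ (N + n)) : z ⊳ 2 ^ N = 0 :=
  op_eq_zero_of_dvd (Nat.pos_of_ne_zero fun h => hz (h ▸ dvd_zero _)) hlt (h z hz)

theorem not_dvd_add {Q y r : ℕ} (hr0 : 0 < r) (hr : r < Q) : ¬ Q ∣ Q * y + r := by
  rw [Nat.dvd_add_right (Dvd.intro _ rfl)]
  exact Nat.not_dvd_of_pos_of_lt hr0 hr

section

variable {n N s u : ℕ}

/-- In this range `topMap` agrees with the `digitMap` of `2 ^ N (2 ^ n - 1) + 1`, an endomorphism;
the term `2 ^ N u` is absorbed by the period `2 ^ N`. -/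
theorem topMap_op_low (hn : 1 ≤ n) (h : AllShortPeriods n) (hN : n ∣ N) (hs : n ∣ s)
    (hsN : s + n ≤ N) {k v : ℕ} (hk : k < 2 ^ n) (hv : ¬ 2 ^ n ∣ v)
    (hvl : v ≤ 2 ^ n * (2 ^ n - 1)) :
    topMap n N s u v ⊳ (2 ^ N * u + 2 ^ s * k) = topMap n N s u (v ⊳ k) := by
  have hq := Nat.two_pow_pos n
  have hqq : 2 ^ n ≤ 2 ^ (n + n) := Nat.pow_le_pow_right (by norm_num) (by omega)
  have hv0 : 0 < v := Nat.pos_of_ne_zero fun h => hv (h ▸ dvd_zero _)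
  have hdm := Nat.div_add_mod v (2 ^ n)
  have hr := Nat.mod_lt v hq
  have hr0 : 0 < v % 2 ^ n := Nat.pos_of_ne_zero fun h => hv (Nat.dvd_of_mod_eq_zero h)
  have row : ∀ y, y < 2 ^ n → (2 ^ N * (2 ^ n - 1) + 1) ⊳ y = 2 ^ N * y := fun y hy => by
    rw [mul_add_one_op hn h hN (by omega), Nat.sub_add_cancel hq, two_pow_op, Nat.mod_eq_of_lt hy]
  have hf : (2 ^ N * (2 ^ n - 1) + 1) ⊳ 2 ^ n = 0 := by
    rw [mul_add_one_op hn h hN (by omega), Nat.sub_add_cancel hq, two_pow_op, Nat.mod_self,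
      Nat.mul_zero]
  have val : ∀ w, w ≤ 2 ^ n * (2 ^ n - 1) →
      topMap n N s u w = digitMap n s (2 ^ N * (2 ^ n - 1) + 1) w := by
    intro w hw
    rw [topMap, if_neg (by omega), digitMap, row]
    have := mul_pred_eq hq hq
    have := Nat.mul_pos hq hq
    exact Nat.div_lt_of_lt_mul (by omega)
  have hy : v / 2 ^ n < 2 ^ n - 1 := by
    by_contra hc
    have := Nat.mul_le_mul_left (2 ^ n) (show 2 ^ n - 1 ≤ v / 2 ^ n by omega)
    omega
  have hsr : 2 ^ s * (v % 2 ^ n) < 2 ^ N := by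
    refine lt_of_lt_of_le (Nat.mul_lt_mul_of_pos_left hr (Nat.two_pow_pos s)) ?_
    rw [← pow_add]; exact Nat.pow_le_pow_right (by norm_num) hsN
  have hzero : topMap n N s u v ⊳ 2 ^ N = 0 := by
    rw [topMap, if_neg (by omega)]
    refine (h N hN).op_eq_zero (not_dvd_add (Nat.mul_pos (Nat.two_pow_pos s) hr0) hsr) ?_
    have := Nat.mul_le_mul_left (2 ^ N) (show v / 2 ^ n + 1 ≤ 2 ^ n by omega)
    rw [pow_add]; rw [Nat.mul_succ] at this; omega
  have hpos : 0 < topMap n N s u v := by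
    rw [topMap, if_neg (by omega)]
    have := Nat.mul_pos (Nat.two_pow_pos s) hr0
    omega
  have hk' : 2 ^ s * k = digitMap n s (2 ^ N * (2 ^ n - 1) + 1) k := by
    rw [digitMap, Nat.div_eq_of_lt hk, op_zero, Nat.mod_eq_of_lt hk, Nat.zero_add]
  rw [op_mul_add_of_eq_zero hpos hzero, val v hvl, hk', digitMap_op hn h hs
    (Dvd.dvd.mul_right (Nat.pow_dvd_pow 2 hsN) _) hf, val]
  exact (op_lt hv0 k).le.trans hvl

/-- The rows of `2 ^ N u + 2 ^ s k + 1` for `0 < k < 2 ^ n`, where `u + 1` is a multiple of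
`2 ^ n`. -/
theorem top_row (hn : 1 ≤ n) (h : AllShortPeriods n) (hN : n ∣ N) (hs : n ∣ s)
    (hsN : s + n ≤ N) (hu : 2 ^ n ∣ u + 1)
    (h₁ : ∀ t, t < 2 ^ n → (2 ^ N * u + 2 ^ s) ⊳ (2 ^ N * u + 2 ^ s * t) = 2 ^ N * t)
    (k : ℕ) (hk0 : 0 < k) (hk : k < 2 ^ n) (t : ℕ) :
    (2 ^ N * u + 2 ^ s * k + 1) ⊳ t =
      topMap n N s u (((2 ^ n * (2 ^ n - 1) + k + 1) ⊳ t) % 2 ^ (n + n)) := by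
  have hq := Nat.two_pow_pos n
  have hqq : 2 ^ n * (2 ^ n - 1) + 2 ^ n = 2 ^ (n + n) := by
    rw [← Nat.mul_succ, Nat.succ_eq_add_one, Nat.sub_add_cancel hq, pow_add]
  have hsk : ∀ k, k < 2 ^ n → 2 ^ s * k < 2 ^ N := fun k hk => by
    refine lt_of_lt_of_le (Nat.mul_lt_mul_of_pos_left hk (Nat.two_pow_pos s)) ?_
    rw [← pow_add]; exact Nat.pow_le_pow_right (by norm_num) hsN
  induction k using Nat.strong_induction_on generalizing t with
  | _ k ih =>
  set c := 2 ^ n * (2 ^ n - 1) + k with hc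
  have hcl : c < 2 ^ (n + n) := by omega
  have hTc : topMap n N s u c = 2 ^ N * u + 2 ^ s * k := topMap_top hk0 hk
  -- Only right multiplication by `c` occurs in the recursion. Multiples of `2 ^ n` use `u ≡ -1`
  -- modulo `2 ^ n`; in the top block, `r = 1` is `h₁` and larger `r` follow from the row for `r -
  -- 1` by `add_two_pow_op`.
  have step : ∀ v, v ≤ c → topMap n N s u v ⊳ (2 ^ N * u + 2 ^ s * k) =
      topMap n N s u ((v ⊳ c) % 2 ^ (n + n)) := by
    intro v hv
    rcases Nat.eq_zero_or_pos v with rfl | hv0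
    · rw [topMap_zero, zero_op, zero_op, Nat.mod_eq_of_lt hcl, hTc]
    have hvc := op_lt hv0 c
    rw [Nat.mod_eq_of_lt (by omega)]
    have short : ¬ 2 ^ n ∣ v → v ⊳ c = v ⊳ k := fun hd =>
      op_mul_add_of_eq_zero hv0 ((h n dvd_rfl).op_eq_zero hd (by omega)) _ _
    by_cases hd : 2 ^ n ∣ v
    · obtain ⟨y, rfl⟩ := hd
      have hy0 : 0 < y := Nat.pos_of_mul_pos_left hv0
      have hy : y < 2 ^ n := by
        have : 2 ^ n * y < 2 ^ n * 2 ^ n := by rw [← pow_add]; omega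
        exact Nat.lt_of_mul_lt_mul_left this
      have hyp : y ⊳ (2 ^ n - 1) = y - 1 := op_last hy0 hy
      have hyu : y ⊳ u = y - 1 := by
        rw [← hyp]
        apply op_congr_right hy0 hy.le
        have := (Nat.modEq_zero_iff_dvd).2 hu
        refine Nat.ModEq.add_right_cancel' 1 ?_
        rw [Nat.sub_add_cancel hq]
        exact this.trans ((Nat.modEq_zero_iff_dvd).2 dvd_rfl).symm
      have h1 : (2 ^ N * y) ⊳ (2 ^ N * u + 2 ^ s * k) = 2 ^ N * (y - 1) + 2 ^ s * k := by
        have e1 := h.mul_op_twice hn hN y u _ (hsk k hk)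
        rw [hyu] at e1
        have e2 := op_lt (Nat.mul_pos (Nat.two_pow_pos N) hy0) (2 ^ N * u + 2 ^ s * k)
        have e3 := mul_pred_add_lt hy0 (hsk k hk)
        have e4 : 2 ^ N * y ≤ 2 ^ (N + n + n) := by
          rw [Nat.add_assoc, pow_add]; exact Nat.mul_le_mul_left _ (by omega)
        exact Nat.ModEq.eq_of_lt_of_lt e1 (by omega) (by omega)
      have h2 : (2 ^ n * y) ⊳ c = 2 ^ n * (y - 1) + k := by
        have e1 := (h n dvd_rfl).mul_op y (2 ^ n - 1) k hk
        rw [hyp] at e1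
        have e3 := mul_pred_add_lt hy0 hk
        exact Nat.ModEq.eq_of_lt_of_lt e1 (by omega) (by omega)
      rw [topMap_mul hy, h1, h2, topMap_low hk (by omega)]
    by_cases hvl : v ≤ 2 ^ n * (2 ^ n - 1)
    · rw [short hd, topMap_op_low hn h hN hs hsN hk hd hvl]
    obtain ⟨r, rfl⟩ : ∃ r, v = 2 ^ n * (2 ^ n - 1) + r := ⟨v - 2 ^ n * (2 ^ n - 1), by omega⟩
    rw [topMap_top (by omega) (by omega)]
    rcases Nat.eq_or_lt_of_le (show 1 ≤ r by omega) with rfl | hr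
    · have h2 : (2 ^ n * (2 ^ n - 1) + 1) ⊳ c = 2 ^ n * k := by
        rw [mul_add_one_op hn h dvd_rfl (by omega), Nat.sub_add_cancel hq, two_pow_op, hc,
          (digits_div_mod hk).2]
      rw [Nat.mul_one, h₁ k hk, h2, topMap_mul hk]
    · have hF := fun t => ih (r - 1) (by omega) (by omega) (by omega) t
      rw [show 2 ^ n * (2 ^ n - 1) + (r - 1) + 1 = 2 ^ n * (2 ^ n - 1) + r by omega] at hF
      have hFq : (2 ^ N * u + 2 ^ s * (r - 1) + 1) ⊳ 2 ^ n = 0 := by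
        rw [hF, (h n dvd_rfl).op_eq_zero hd (by omega), Nat.zero_mod, topMap_zero]
      have hx : 2 ^ s ∣ 2 ^ N * u + 2 ^ s * (r - 1) :=
        Nat.dvd_add ((Nat.pow_dvd_pow 2 (by omega)).mul_right _) (Dvd.intro _ rfl)
      have e1 : 2 ^ N * u + 2 ^ s * r = 2 ^ N * u + 2 ^ s * (r - 1) + 2 ^ s := by
        rw [Nat.add_assoc, ← Nat.mul_succ, Nat.succ_eq_add_one, Nat.sub_add_cancel (by omega)]
      have e2 : 2 ^ N * u + 2 ^ s * k = 2 ^ s * (2 ^ n * (2 ^ (N - (s + n)) * u) + k) + 0 := by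
        conv_lhs => rw [show N = s + n + (N - (s + n)) by omega, pow_add, pow_add]
        ring
      rw [e1, add_two_pow_op (h s hs) hn hx hFq, e2, blockMap_add (Nat.two_pow_pos s),
        op_mul_add_of_eq_zero (Nat.succ_pos _) hFq, hF, ← short hd, Nat.mod_eq_of_lt (by omega),
        Nat.add_zero]
  refine row_eq (X := 2 ^ N * u + 2 ^ s * k + 1) (L₀ := n + n + 1) (Nat.succ_pos _)
    (fun t => topMap n N s u (((c + 1) ⊳ t) % 2 ^ (n + n))) (fun L hL => ?_) (fun t => ?_) t
  · have : 2 ^ (n + n + 1) ≤ 2 ^ L := Nat.pow_le_pow_right (by norm_num) hL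
    rw [pow_succ] at this
    rw [op_last (Nat.succ_pos c) (by omega), Nat.succ_sub_one, Nat.mod_eq_of_lt hcl, hTc,
      Nat.succ_sub_one]
  · have hlt : ((c + 1) ⊳ (t + 1)) % 2 ^ (n + n) ≤ c :=
      (Nat.mod_le _ _).trans (Nat.le_of_lt_succ (op_lt (Nat.succ_pos c) _))
    rw [Nat.succ_sub_one, step _ hlt]
    congr 1
    rw [op_step (Nat.succ_pos c) t, Nat.succ_sub_one]
    exact (op_modEq (Nat.mod_modEq _ _) rfl).symm

end

/-- Climb from `W + 1`, where `W = 2 ^ (K + 2 n) u`: a block map for `h₂`, which allows period `2 ^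
(2 n)`, reaches `W + 2 ^ K`; `top_row` with `s = K` and a second such map reach `W + 2 ^ (K + n)`;
for `r > 1`, `top_row` with `s = K + n` and a last block map finish. -/
theorem dvd_op_of_dvd_succ {n K u r : ℕ} (hn : 1 ≤ n) (h : AllShortPeriods n) (hK : n ∣ K)
    (h₂ : ShortPeriods (n + n) K) (hu : 2 ^ n ∣ u + 1) (hul : u < 2 ^ (n + n))
    (hr0 : 0 < r) (hr : r < 2 ^ n) :
    (2 ^ (K + n + n) * u + 2 ^ (K + n) * r) ⊳ 2 ^ (K + n + n) = 0 := by
  have hq := Nat.two_pow_pos n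
  have hqq : 2 ^ n * (2 ^ n - 1) + 2 ^ n = 2 ^ (n + n) := by
    rw [← Nat.mul_succ, Nat.succ_eq_add_one, Nat.sub_add_cancel hq, pow_add]
  have hKn : n ∣ K + n := Nat.dvd_add hK dvd_rfl
  have hN : n ∣ K + n + n := Nat.dvd_add hKn dvd_rfl
  set W := 2 ^ (K + n + n) * u with hW
  have hWK : W = 2 ^ K * (2 ^ (n + n) * u) := by rw [hW, Nat.add_assoc, pow_add, Nat.mul_assoc]
  have hWKn : W = 2 ^ (K + n) * (2 ^ n * u) := by rw [hW, pow_add _ (K + n), Nat.mul_assoc]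
  have hφ := mul_add_one_op hn h hN hul
  rw [← hW] at hφ
  have hφq : (W + 1) ⊳ 2 ^ (n + n) = 0 := by
    rw [hφ, op_two_pow_self hul (Nat.succ_pos u), Nat.mul_zero]
  have hφt : ∀ t, t < 2 ^ n → (W + 1) ⊳ t = 2 ^ (K + n + n) * t := by
    intro t ht
    rw [hφ]
    congr 1
    obtain ⟨y, hy⟩ := hu
    have e1 := (h n dvd_rfl).mul_op y 0 t ht
    rw [op_zero, Nat.mul_zero, Nat.zero_add, ← hy] at e1
    have : (u + 1) ⊳ t < u + 1 := op_lt (Nat.succ_pos u) t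
    exact Nat.ModEq.eq_of_lt_of_lt e1 (by omega) (by omega)
  have hfirst : ∀ t, t < 2 ^ n → (W + 2 ^ K) ⊳ (W + 2 ^ K * t) = 2 ^ (K + n + n) * t := by
    intro t ht
    have e : W + 2 ^ K * t = 2 ^ K * (2 ^ (n + n) * u + t) + 0 := by rw [hWK]; ring
    rw [add_two_pow_op h₂ (by omega) (hWK ▸ Dvd.intro _ rfl) hφq, e,
      blockMap_add (Nat.two_pow_pos K), op_mul_add_of_eq_zero (Nat.succ_pos W) hφq, hφt t ht,
      Nat.add_zero]
  have hlast := top_row hn h hN hK (by omega) hu hfirst (2 ^ n - 1) (by omega) (by omega)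
  rw [← hW] at hlast
  set x := W + 2 ^ K * (2 ^ n - 1) with hx
  have hlast' : ∀ t, t < 2 ^ n → (x + 1) ⊳ (2 ^ n * t) = 2 ^ (K + n + n) * t := by
    intro t ht
    have e1 : 2 ^ n * t < 2 ^ (n + n) := by
      rw [pow_add]; exact Nat.mul_lt_mul_of_pos_left ht hq
    rw [hlast, show 2 ^ n * (2 ^ n - 1) + (2 ^ n - 1) + 1 = 2 ^ (n + n) by omega, two_pow_op,
      Nat.mod_mod, Nat.mod_eq_of_lt e1, topMap_mul ht]
  have hlastq : (x + 1) ⊳ 2 ^ (n + n) = 0 := by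
    rw [hlast, show 2 ^ n * (2 ^ n - 1) + (2 ^ n - 1) + 1 = 2 ^ (n + n) by omega, two_pow_op,
      Nat.mod_self, Nat.zero_mod, topMap_zero]
  have hxK : 2 ^ K ∣ x := Nat.dvd_add (hWK ▸ Dvd.intro _ rfl) (Dvd.intro _ rfl)
  have hxe : W + 2 ^ (K + n) = x + 2 ^ K := by
    rw [hx, Nat.add_assoc, ← Nat.mul_succ, Nat.succ_eq_add_one, Nat.sub_add_cancel hq, pow_add]
  have hrow := add_two_pow_op h₂ (by omega) hxK hlastq
  rw [← hxe] at hrow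
  rcases Nat.eq_or_lt_of_le (show 1 ≤ r by omega) with rfl | hr1
  · have e : 2 ^ (K + n + n) = 2 ^ K * 2 ^ (n + n) + 0 := by rw [Nat.add_assoc, pow_add]; rfl
    rw [Nat.mul_one, hrow, e, blockMap_add (Nat.two_pow_pos K), hlastq]
  · have hsecond : ∀ t, t < 2 ^ n →
        (W + 2 ^ (K + n)) ⊳ (W + 2 ^ (K + n) * t) = 2 ^ (K + n + n) * t := by
      intro t ht
      have e : W + 2 ^ (K + n) * t = 2 ^ K * (2 ^ (n + n) * u + 2 ^ n * t) + 0 := by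
        rw [hWK, pow_add 2 K]; ring
      rw [hrow, e, blockMap_add (Nat.two_pow_pos K),
        op_mul_add_of_eq_zero (Nat.succ_pos x) hlastq, hlast' t ht, Nat.add_zero]
    have hF := top_row hn h hN hKn le_rfl hu hsecond (r - 1) (by omega) (by omega) (2 ^ n)
    rw [← hW, show 2 ^ n * (2 ^ n - 1) + (r - 1) + 1 = 2 ^ n * (2 ^ n - 1) + r by omega,
      (h n dvd_rfl).op_eq_zero (not_dvd_add hr0 hr) (by omega), Nat.zero_mod, topMap_zero] at hF
    have e1 : W + 2 ^ (K + n) * r = W + 2 ^ (K + n) * (r - 1) + 2 ^ (K + n) := by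
      rw [Nat.add_assoc, ← Nat.mul_succ, Nat.succ_eq_add_one, Nat.sub_add_cancel (by omega)]
    have e : 2 ^ (K + n + n) = 2 ^ (K + n) * 2 ^ n + 0 := by rw [pow_add]; rfl
    rw [e1, add_two_pow_op (h _ hKn) hn
      (Nat.dvd_add (hWKn ▸ Dvd.intro _ rfl) (Dvd.intro _ rfl)) hF, e,
      blockMap_add (Nat.two_pow_pos _), hF]

/-! ### Doubling `n` -/

theorem ShortPeriods.of_allShortPeriods {n K : ℕ} (hn : 1 ≤ n) (h : AllShortPeriods n)
    (hK : n ∣ K) (h₂ : ShortPeriods (n + n) K) : ShortPeriods (n + n) (K + n + n) := by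
  have hKn : n ∣ K + n := Nat.dvd_add hK dvd_rfl
  have hN : n ∣ K + n + n := Nat.dvd_add hKn dvd_rfl
  have hq := Nat.two_pow_pos n
  have key : ∀ z, z < 2 ^ (K + n + n + n + n) → ¬ 2 ^ (K + n + n) ∣ z →
      2 ^ (K + n + n + n + n) ∣ z ⊳ 2 ^ (K + n + n) := by
    intro z
    induction z using Nat.strong_induction_on with
    | _ z ih =>
    intro hzl hz
    by_cases hz1 : 2 ^ (K + n) ∣ z
    · obtain ⟨y, rfl⟩ := hz1
      have hr0 : 0 < y % 2 ^ n := by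
        refine Nat.pos_of_ne_zero fun hc => hz ?_
        rw [pow_add 2 (K + n)]
        exact Nat.mul_dvd_mul_left _ (Nat.dvd_of_mod_eq_zero hc)
      have hr := Nat.mod_lt y hq
      have e : 2 ^ (K + n) * y =
          2 ^ (K + n + n) * (y / 2 ^ n) + 2 ^ (K + n) * (y % 2 ^ n) := by
        rw [pow_add 2 (K + n), Nat.mul_assoc, ← Nat.mul_add, Nat.div_add_mod]
      have hul : y / 2 ^ n < 2 ^ (n + n) := by
        rw [Nat.div_lt_iff_lt_mul hq, ← pow_add]
        rw [show K + n + n + n + n = K + n + (n + n + n) by omega, pow_add 2 (K + n)] at hzl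
        exact Nat.lt_of_mul_lt_mul_left hzl
      rw [e]
      have hzero : (2 ^ (K + n + n) * (y / 2 ^ n) + 2 ^ (K + n) * (y % 2 ^ n)) ⊳
          2 ^ (K + n + n) = 0 := by
        by_cases hu : 2 ^ n ∣ y / 2 ^ n + 1
        · exact dvd_op_of_dvd_succ hn h hK h₂ hu hul hr0 hr
        · refine add_op_two_pow (h _ hN) hn (Dvd.intro _ rfl) ?_
            (Nat.mul_pos (Nat.two_pow_pos _) hr0) ?_
          · rw [mul_add_one_op hn h hN hul, (h n dvd_rfl).op_eq_zero hu hul, Nat.mul_zero]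
          · rw [pow_add 2 (K + n)]
            exact Nat.mul_lt_mul_of_pos_left hr (Nat.two_pow_pos _)
      rw [hzero]; exact dvd_zero _
    · exact dvd_op_of_not_dvd hn h hKn (fun y hy => ih y hy (hy.trans hzl)) hz1
  intro z hz
  rw [← Nat.add_assoc]
  have hd : 2 ^ (K + n + n) ∣ 2 ^ (K + n + n + n + n) := Nat.pow_dvd_pow 2 (by omega)
  refine (Nat.ModEq.dvd_iff (op_modEq_mod_left (K + n + n + n + n) z _) dvd_rfl).1
    (key _ (Nat.mod_lt _ (Nat.two_pow_pos _)) fun hc => hz ((Nat.dvd_mod_iff hd).1 hc))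

theorem AllShortPeriods.double {n : ℕ} (hn : 1 ≤ n) (h : AllShortPeriods n) :
    AllShortPeriods (n + n) := by
  rintro _ ⟨m, rfl⟩
  induction m with
  | zero => intro z hz; exact absurd (by simp) hz
  | succ m ih =>
    rw [Nat.mul_succ, ← Nat.add_assoc]
    exact ShortPeriods.of_allShortPeriods hn h
      (Dvd.dvd.mul_right (Nat.dvd_add dvd_rfl dvd_rfl) m) ih

theorem allShortPeriods_two_pow (k : ℕ) : AllShortPeriods (2 ^ k) := by
  induction k with
  | zero => exact allShortPeriods_one
  | succ k ih => rw [pow_succ, Nat.mul_two]; exact ih.double Nat.one_le_two_pow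

/-! ### Period length and conclusion -/

/-- At a period `r` the row vanishes, hence so do both summands: `2 ^ n` divides `r`, and the
quotient is a zero, thus a period, of the row of `x + 1`. -/
theorem isPeriodLength_of_digitMap {n s x y l : ℕ}
    (hy : ∀ t, y ⊳ t = digitMap n s (x + 1) t) (hl : IsPeriodLength (x + 1) (2 ^ l)) :
    IsPeriodLength y (2 ^ (l + n)) := by
  have hq := Nat.two_pow_pos n
  refine ⟨⟨by positivity, fun i => ?_⟩, fun r hr => ?_⟩
  · rw [hy, hy, digitMap, digitMap, pow_add, Nat.add_mul_div_right _ _ hq, Nat.add_mul_mod_self_right,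
      hl.1.2]
  · have h0 := hr.2 0
    rw [Nat.zero_add, op_zero, hy, digitMap, Nat.add_eq_zero_iff, Nat.mul_eq_zero] at h0
    obtain ⟨k, rfl⟩ : 2 ^ n ∣ r :=
      Nat.dvd_of_mod_eq_zero (h0.2.resolve_left (Nat.two_pow_pos s).ne')
    rw [Nat.mul_div_cancel_left _ hq] at h0
    rw [pow_add, Nat.mul_comm]
    apply Nat.mul_le_mul_left
    refine hl.2 ⟨Nat.pos_of_mul_pos_left hr.1, fun i => ?_⟩
    rw [Nat.add_comm i k]
    exact op_add_of_eq_zero (Nat.succ_pos x) h0.1 i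

end LaverBack

theorem corollary4p2 (a x m n l : ℕ)
    (hn : ∃ k : ℕ, n = 2 ^ k)
    (hx : 2 ^ ((m + 1) * n) ∣ x)
    (ha : a = x + 2 ^ (m * n) * (2 ^ n - 1))
    (hperiod : LaverBack.IsPeriodLength (x + 1) (2 ^ l))
    (hl : l ≤ n) :
    LaverBack.IsPeriodLength (a + 1) (2 ^ (l + n)) ∧
      ∀ i i' : ℕ, i' < 2 ^ n →
        LaverBack.bInf (a + 1) (2 ^ n * i + i') =
          LaverBack.bInf (x + 1) i + 2 ^ (m * n) * i' := by
  open LaverBack in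
  obtain ⟨k, rfl⟩ := hn
  -- The bound `l ≤ n` makes `2 ^ n` a multiple of the period.
  have hf : (x + 1) ⊳ 2 ^ 2 ^ k = 0 := by
    have h0 := hperiod.1.2 0
    rw [Nat.zero_add, op_zero] at h0
    obtain ⟨c, hc⟩ := Nat.pow_dvd_pow 2 hl
    rw [hc, ← Nat.add_zero (2 ^ l * c), op_mul_add_of_eq_zero (Nat.succ_pos x) h0, op_zero]
  rw [Nat.succ_mul] at hx
  have row : ∀ t, (a + 1) ⊳ t = digitMap (2 ^ k) (m * 2 ^ k) (x + 1) t := fun t => by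
    rw [ha, add_mul_op Nat.one_le_two_pow (allShortPeriods_two_pow k) (Nat.dvd_mul_left _ m) hx hf]
  exact ⟨isPeriodLength_of_digitMap row hperiod, fun i i' hi => by rw [row, digitMap_add hi]⟩
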